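/- For $\nu\in\mathbb C$ let $$J_\nu(z)=\left(\tfrac z2\right)^{\nu}\sum_{n=0}^\infty\frac{(-1)^n}{n!\,\Gamma(n+\nu+1)}\left(\tfrac{z^2}{4}\right)^{n}$$ be the Bessel function of the first kind, where $1/\Gamma=0$ at the poles of $\Gamma$ and the power is the principal one ($\arg z\in(-\pi,\pi]$). Let $N\ge 1$ be an integer, let $a_1,\dots,a_N$ be nonzero real numbers, $\nu_1,\dots,\nu_N$ complex numbers and $k$ an integer. Let $J=\{j:\nu_j\in\{-1,-2,-3,\dots\}\}$, and assume: 1. $k\ge-\sum_{j\in J}|\nu_j|$ (so $k\ge 0$ if no $\nu_j$ is a negative integer); 2. $\sum_{j=1}^N|a_j|\le 2\pi$; 3. $\sum_{j=1}^N\operatorname{Re}\nu_j>2k-\frac N2$; 4. $\sum_{j=1}^N\operatorname{Re}\nu_j>2k-\frac N2+1$ if $\sum_{j=1}^N|a_j|=2\pi$ or if there are signs $s_1,\dots,s_N\in\{1,-1\}$ with $\sum_{j=1}^N s_ja_j=0$. Put $f(t)=t^{2k}\prod_{j=1}^N\left[t^{-\nu_j}J_{\nu_j}(a_jt)\right]$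 for $t>0$. Then the limit $f(0):=\lim_{t\to0^+}f(t)$ exists, the improper integral and the series below converge (possibly only conditionally, as limits of $\int_0^T$ as $T\to\infty$ and of the partial sums), and $$\int_0^\infty t^{2k}\prod_{j=1}^N\left[t^{-\nu_j}J_{\nu_j}(a_jt)\right]dt=\sum_{m=0}^\infty\varepsilon_m\,m^{2k}\prod_{j=1}^N\left[m^{-\nu_j}J_{\nu_j}(a_jm)\right],$$ where $\varepsilon_0=\frac12$, $\varepsilon_m=1$ for $m\ge1$, and the term $m=0$ of the series is $\varepsilon_0f(0)$. -/

import Mathlib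

open Filter Topology MeasureTheory

/-- The Bessel function of the first kind `J_ν(z)` of complex order `ν`, by its everywhere
convergent series `(z/2)^ν ∑ (-1)^n (z²/4)^n / (n! Γ(n + ν + 1))`. The power is the principal one
(`arg z ∈ (-π, π]`). At the poles of `Γ` Mathlib's `Complex.Gamma` takes the value `0`, and
`x / 0 = 0`, so that `1 / Γ` is there `0`, as the standard definition requires. -/
noncomputable def besselJ (ν z : ℂ) : ℂ :=
  (z / 2) ^ ν *
    ∑' n : ℕ, (-1) ^ n * (z ^ 2 / 4) ^ n / ((n.factorial : ℂ) * Complex.Gamma (n + ν + 1))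

/-- The function `t ↦ t^{2k} ∏_j t^{-ν_j} J_{ν_j}(a_j t)`, for `t > 0`. -/
noncomputable def besselProduct {N : ℕ} (k : ℤ) (ν : Fin N → ℂ) (a : Fin N → ℝ) (t : ℝ) : ℂ :=
  (t : ℂ) ^ (2 * k) * ∏ j, (t : ℂ) ^ (-ν j) * besselJ (ν j) ((a j : ℂ) * (t : ℂ))

/-- The weights `ε_0 = 1/2` and `ε_m = 1` for `m ≥ 1`. -/
noncomputable def epsilonWeight (m : ℕ) : ℂ := if m = 0 then 1 / 2 else 1

/-- The term of index `m` of the series: the value at `m` of `besselProduct` if `m ≥ 1`, and for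
`m = 0` the given number `f₀` (in use: the limit of `besselProduct` at `0+`). -/
noncomputable def besselProductAt {N : ℕ} (k : ℤ) (ν : Fin N → ℂ) (a : Fin N → ℝ) (f₀ : ℂ)
    (m : ℕ) : ℂ :=
  if m = 0 then f₀ else besselProduct k ν a (m : ℝ)

/-- `∫_0^∞ f(t) dt = I` as a (possibly conditionally convergent) improper integral: `f` is
integrable on every `[0, T]`, and `∫_0^T f(t) dt → I` as `T → ∞`. -/
def HasImproperIntegral (f : ℝ → ℂ) (I : ℂ) : Prop :=
  (∀ T : ℝ, 0 < T → IntervalIntegrable f volume 0 T) ∧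
    Tendsto (fun T : ℝ => ∫ t in (0 : ℝ)..T, f t) atTop (𝓝 I)

/-- `∑_{m=0}^∞ u m = S` as a (possibly conditionally convergent) series. -/
def HasSeriesSum (u : ℕ → ℂ) (S : ℂ) : Prop :=
  Tendsto (fun M : ℕ => ∑ m ∈ Finset.range M, u m) atTop (𝓝 S)

/-! For t > 0 the integrand is a constant times F(t) = t^{2K} ∏ g_j(a_j t), where g_j(z) =
(z/2)^{-ν} J_ν(z) is even and entire. Negative integer orders -n are first reflected to n; this
costs a factor t^{2n}, and hypothesis 1 says exactly that the resulting K is nonnegative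
(`exists_besselProduct_eq`). So the claim concerns an even entire function of exponential type at
most A = ∑ |a_j| ≤ 2π that is O(t^{-δ}) at +∞, with δ = ∑ Re ν_j + N/2 - 2k > 0.

The comparison of sum and integral is the Abel–Plana formula (`sum_sub_integral_eq`). The kernel -i
cot πz has poles at the integers, so its product with F, integrated around a rectangle with vertical
sides at ±(M + 1/2), yields the partial sum. By evenness and Cauchy's theorem, subtracting the
integral of F amounts to replacing the kernel by kernel + 1, which is O(e^{-2π Im z}) and beats the
growth of F if A < 2π. Phragmén–Lindelöf (`norm_mul_max_rpow_le_of_even`) carries the decay of F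
from the real axis to the vertical sides. Hence the partial sum minus the integral up to M + 1/2
tends to 0 for every δ > 0.

Convergence of the integral is a separate matter. If δ > 1 it is absolute, and type 2π is then
reached by applying the formula to F(rz) and letting r → 1⁻ (`tendsto_sum_integral_of_type_le`). If
δ ≤ 1, hypothesis 4 gives A < 2π and makes every frequency ∑ ±a_j nonzero; the leading asymptotics
of F are then purely oscillating, and the integral converges by parts
(`exists_tendsto_integral_of_oscillating`). -/

/-! ### The Bessel–Clifford series and the even entire part of `J_ν` -/

/-- The coefficients `1 / (n! Γ(n + ν + 1))` of the Bessel–Clifford function. -/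
noncomputable def cliffordCoeff (ν : ℂ) (n : ℕ) : ℂ :=
  ((n.factorial : ℂ) * Complex.Gamma (n + ν + 1))⁻¹

/-- The Bessel–Clifford function `∑ wⁿ / (n! Γ(n + ν + 1))`. -/
noncomputable def cliffordC (ν w : ℂ) : ℂ := ∑' n : ℕ, cliffordCoeff ν n * w ^ n

/-- The even entire function `(z/2)^(-ν) J_ν(z)`. -/
noncomputable def besselEntire (ν z : ℂ) : ℂ := cliffordC ν (-(z ^ 2 / 4))

lemma cliffordCoeff_succ (ν : ℂ) (n : ℕ) :
    ((n : ℂ) + 1) * cliffordCoeff ν (n + 1) = cliffordCoeff (ν + 1) n := by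
  have h : (n : ℂ) + 1 ≠ 0 := by exact_mod_cast n.succ_ne_zero
  have e : ((n + 1 : ℕ) : ℂ) + ν + 1 = n + (ν + 1) + 1 := by push_cast; ring
  rw [cliffordCoeff, cliffordCoeff, e, Nat.factorial_succ, Nat.cast_mul, mul_assoc, mul_inv]
  push_cast
  rw [mul_inv_cancel_left₀ h]

lemma cliffordCoeff_eq_mul (ν : ℂ) (n : ℕ) :
    cliffordCoeff ν n = ((n : ℂ) + ν + 1) * cliffordCoeff (ν + 1) n := by
  have h := Complex.one_div_Gamma_eq_self_mul_one_div_Gamma_add_one ((n : ℂ) + ν + 1)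
  rw [cliffordCoeff, cliffordCoeff, mul_inv, mul_inv, h,
    show (n : ℂ) + (ν + 1) + 1 = n + ν + 1 + 1 by ring]
  ring

/-- After multiplication by (2n)! the ratio of consecutive coefficients has modulus 2(2n+1) /
|n+ν+1|, which tends to 4 and so is eventually at most 4r. This permits a termwise comparison with a
cosh series, whence the sharp exponential type. -/
lemma exists_norm_cliffordCoeff_le (ν : ℂ) {r : ℝ} (hr : 1 < r) :
    ∃ C : ℝ, 0 ≤ C ∧ ∀ n : ℕ, ‖cliffordCoeff ν n‖ ≤ C * (4 * r) ^ n / (2 * n).factorial := by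
  set X : ℕ → ℝ := fun n => ‖cliffordCoeff ν n‖ * (2 * n).factorial with hX
  have hX0 : ∀ n, 0 ≤ X n := fun n => by positivity
  obtain ⟨n₀, hn₀⟩ := exists_nat_ge (r * ‖ν‖ / (r - 1))
  have hstep : ∀ n, n₀ ≤ n → X (n + 1) ≤ 4 * r * X n := by
    intro n hn
    have h1 : ‖cliffordCoeff ν n‖ = ‖(n : ℂ) + ν + 1‖ * ((n + 1) * ‖cliffordCoeff ν (n + 1)‖) := by
      rw [cliffordCoeff_eq_mul ν n, ← cliffordCoeff_succ ν n, norm_mul, norm_mul]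
      congr 2
      exact_mod_cast Complex.norm_natCast (n + 1)
    have h2 : (n : ℝ) + 1 - ‖ν‖ ≤ ‖(n : ℂ) + ν + 1‖ := by
      have := norm_sub_norm_le ((n : ℂ) + 1) (-ν)
      have h3 : ‖(n : ℂ) + 1‖ = n + 1 := by exact_mod_cast Complex.norm_natCast (n + 1)
      rw [norm_neg, h3, show (n : ℂ) + 1 - -ν = n + ν + 1 by ring] at this
      exact this
    have h4 : r * ‖ν‖ ≤ n * (r - 1) := by
      rw [← div_le_iff₀ (by linarith)]
      exact hn₀.trans (by exact_mod_cast hn)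
    have h5 : 2 * (n : ℝ) + 1 ≤ 2 * r * ‖(n : ℂ) + ν + 1‖ := by
      nlinarith [mul_le_mul_of_nonneg_left h2 (by linarith : (0 : ℝ) ≤ 2 * r)]
    have hf : (((2 * (n + 1)).factorial : ℕ) : ℝ) = (2 * n + 2) * (2 * n + 1) * (2 * n).factorial := by
      rw [show 2 * (n + 1) = 2 * n + 1 + 1 by ring, Nat.factorial_succ, Nat.factorial_succ]
      push_cast; ring
    simp only [hX]
    rw [h1, hf]
    have h6 : (0 : ℝ) ≤ (2 * (n : ℝ) + 2) * ‖cliffordCoeff ν (n + 1)‖ * (2 * n).factorial := by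
      positivity
    nlinarith [mul_le_mul_of_nonneg_left h5 h6]
  have hr0 : (0 : ℝ) < 4 * r := by linarith
  refine ⟨∑ i ∈ Finset.range (n₀ + 1), X i / (4 * r) ^ i,
    Finset.sum_nonneg fun i _ => div_nonneg (hX0 i) (by positivity), fun n => ?_⟩
  rw [le_div_iff₀ (by positivity)]
  change X n ≤ _
  have hsmall : ∀ i, i ≤ n₀ → X i ≤ (∑ i ∈ Finset.range (n₀ + 1), X i / (4 * r) ^ i) * (4 * r) ^ i := by
    intro i hi
    rw [← div_le_iff₀ (by positivity)]
    exact Finset.single_le_sum (f := fun i => X i / (4 * r) ^ i)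
      (fun i _ => div_nonneg (hX0 i) (by positivity)) (Finset.mem_range.2 (by omega))
  rcases le_total n n₀ with h | h
  · exact hsmall n h
  · induction n, h using Nat.le_induction with
    | base => exact hsmall _ le_rfl
    | succ n hn ih =>
      refine (hstep n hn).trans ?_
      rw [pow_succ]
      nlinarith

lemma exists_norm_cliffordCoeff_mul_pow_le (ν : ℂ) {σ : ℝ} (hσ : 1 < σ) :
    ∃ C : ℝ, 0 ≤ C ∧ ∀ (R : ℝ) (w : ℂ) (n : ℕ), ‖w‖ ≤ R ^ 2 / 4 →
      ‖cliffordCoeff ν n * w ^ n‖ ≤ C * ((σ * R) ^ (2 * n) / (2 * n).factorial) := by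
  obtain ⟨C, hC, h⟩ := exists_norm_cliffordCoeff_le ν (r := σ ^ 2) (by nlinarith)
  refine ⟨C, hC, fun R w n hw => ?_⟩
  rw [norm_mul, norm_pow]
  calc ‖cliffordCoeff ν n‖ * ‖w‖ ^ n
      ≤ C * (4 * σ ^ 2) ^ n / (2 * n).factorial * (R ^ 2 / 4) ^ n := by
        gcongr
        exact h n
    _ = C * ((σ * R) ^ (2 * n) / (2 * n).factorial) := by
        rw [pow_mul (σ * R) 2 n, show (σ * R) ^ 2 = 4 * σ ^ 2 * (R ^ 2 / 4) by ring,
          mul_pow (4 * σ ^ 2) (R ^ 2 / 4) n]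
        generalize (4 * σ ^ 2) ^ n = A
        generalize (R ^ 2 / 4) ^ n = B
        ring

/-- The cosh majorant is uniform on a disc around 0 containing w, so the series may be
differentiated termwise; by `cliffordCoeff_succ` this raises the order by one. -/
lemma hasDerivAt_cliffordC_and_hasSum (ν w : ℂ) :
    HasSum (fun n => cliffordCoeff ν n * w ^ n) (cliffordC ν w) ∧
      HasDerivAt (cliffordC ν) (cliffordC (ν + 1) w) w := by
  obtain ⟨C, hC, h⟩ := exists_norm_cliffordCoeff_mul_pow_le ν (one_lt_two)
  set R : ℝ := 2 * √(‖w‖ + 1)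
  have hR : R ^ 2 / 4 = ‖w‖ + 1 := by
    rw [mul_pow, Real.sq_sqrt (by positivity)]; ring
  have hu : Summable fun n : ℕ => C * ((2 * R) ^ (2 * n) / (2 * n).factorial) :=
    (Real.hasSum_cosh (2 * R)).summable.mul_left C
  have hU : IsOpen (Metric.ball (0 : ℂ) (‖w‖ + 1)) := Metric.isOpen_ball
  have hw : w ∈ Metric.ball (0 : ℂ) (‖w‖ + 1) := by simp
  have hle : ∀ (n : ℕ) (z : ℂ), z ∈ Metric.ball (0 : ℂ) (‖w‖ + 1) →
      ‖cliffordCoeff ν n * z ^ n‖ ≤ C * ((2 * R) ^ (2 * n) / (2 * n).factorial) := by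
    intro n z hz
    apply h R
    rw [hR]
    simpa using (Metric.mem_ball.1 hz).le
  have hd : ∀ n : ℕ, DifferentiableOn ℂ (fun z : ℂ => cliffordCoeff ν n * z ^ n)
      (Metric.ball (0 : ℂ) (‖w‖ + 1)) := fun n => by fun_prop
  have hsum : HasSum (fun n => cliffordCoeff ν n * w ^ n) (cliffordC ν w) :=
    (Summable.of_norm_bounded hu fun n => hle n w hw).hasSum
  refine ⟨hsum, ?_⟩
  have h1 := Complex.hasSum_deriv_of_summable_norm hu hd hU hle hw
  have h2 : HasDerivAt (cliffordC ν) (deriv (cliffordC ν) w) w :=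
    ((Complex.differentiableOn_tsum_of_summable_norm hu hd hU hle).differentiableAt
      (hU.mem_nhds hw)).hasDerivAt
  convert! h2 using 1
  have h3 : ∀ n : ℕ, deriv (fun z : ℂ => cliffordCoeff ν n * z ^ n) w
      = cliffordCoeff ν n * (n * w ^ (n - 1)) := fun n => by
    rw [deriv_const_mul_field]; simp
  simp only [h3] at h1
  have h4 := (hasSum_nat_add_iff' 1).2 h1
  simp only [Finset.range_one, Finset.sum_singleton, Nat.cast_zero, zero_mul, mul_zero, sub_zero,
    Nat.add_sub_cancel] at h4
  rw [cliffordC]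
  refine Eq.trans (tsum_congr fun n => ?_) h4.tsum_eq
  rw [← cliffordCoeff_succ]; push_cast; ring

lemma hasSum_cliffordC (ν w : ℂ) :
    HasSum (fun n => cliffordCoeff ν n * w ^ n) (cliffordC ν w) :=
  (hasDerivAt_cliffordC_and_hasSum ν w).1

lemma hasDerivAt_cliffordC (ν w : ℂ) : HasDerivAt (cliffordC ν) (cliffordC (ν + 1) w) w :=
  (hasDerivAt_cliffordC_and_hasSum ν w).2

lemma cliffordC_recurrence (ν w : ℂ) :
    cliffordC ν w = (ν + 1) * cliffordC (ν + 1) w + w * cliffordC (ν + 2) w := by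
  have h0 := (hasSum_cliffordC (ν + 1) w).mul_left (ν + 1)
  have h1 := (hasSum_cliffordC (ν + 2) w).mul_left w
  have h2 : HasSum (fun n : ℕ => (n : ℂ) * cliffordCoeff (ν + 1) n * w ^ n)
      (w * cliffordC (ν + 2) w) := by
    rw [← hasSum_nat_add_iff' 1]
    simp only [Finset.range_one, Finset.sum_singleton, Nat.cast_zero, zero_mul, sub_zero]
    convert! h1 using 2 with n
    rw [show ν + 2 = ν + 1 + 1 by ring, ← cliffordCoeff_succ (ν + 1)]
    push_cast; ring
  refine HasSum.unique (hasSum_cliffordC ν w) ?_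
  convert! h0.add h2 using 2 with n
  rw [cliffordCoeff_eq_mul]; ring

lemma differentiable_besselEntire (ν : ℂ) : Differentiable ℂ (besselEntire ν) := by
  have h : Differentiable ℂ (cliffordC ν) := fun w => (hasDerivAt_cliffordC ν w).differentiableAt
  unfold besselEntire
  fun_prop

lemma hasDerivAt_besselEntire (ν z : ℂ) :
    HasDerivAt (besselEntire ν) (-(z / 2) * besselEntire (ν + 1) z) z := by
  have h1 : HasDerivAt (fun z : ℂ => -(z ^ 2 / 4)) (-(z / 2)) z := by
    convert! ((hasDerivAt_pow 2 z).div_const 4).neg using 1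
    push_cast; ring
  convert! (hasDerivAt_cliffordC ν _).comp z h1 using 1
  rw [besselEntire]; ring

lemma besselEntire_recurrence (ν z : ℂ) :
    besselEntire ν z = (ν + 1) * besselEntire (ν + 1) z - z ^ 2 / 4 * besselEntire (ν + 2) z := by
  rw [besselEntire, cliffordC_recurrence, besselEntire, besselEntire]; ring

lemma besselEntire_neg (ν z : ℂ) : besselEntire ν (-z) = besselEntire ν z := by
  simp [besselEntire]

lemma exists_norm_besselEntire_le (ν : ℂ) {σ : ℝ} (hσ : 1 < σ) :
    ∃ C : ℝ, 0 ≤ C ∧ ∀ z, ‖besselEntire ν z‖ ≤ C * Real.exp (σ * ‖z‖) := by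
  obtain ⟨C, hC, h⟩ := exists_norm_cliffordCoeff_mul_pow_le ν hσ
  refine ⟨C, hC, fun z => ?_⟩
  have h1 : ‖besselEntire ν z‖ ≤ C * Real.cosh (σ * ‖z‖) :=
    tsum_of_norm_bounded ((Real.hasSum_cosh (σ * ‖z‖)).mul_left C) fun n =>
      h ‖z‖ _ n (by simp)
  refine h1.trans (mul_le_mul_of_nonneg_left ?_ hC)
  have h0 : 0 ≤ σ * ‖z‖ := by positivity
  rw [Real.cosh_eq]
  have : Real.exp (-(σ * ‖z‖)) ≤ Real.exp (σ * ‖z‖) := Real.exp_le_exp.2 (by linarith)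
  linarith

lemma besselJ_eq (ν z : ℂ) : besselJ ν z = (z / 2) ^ ν * besselEntire ν z := by
  rw [besselJ, besselEntire, cliffordC]
  congr 1
  refine tsum_congr fun n => ?_
  rw [cliffordCoeff, ← neg_one_mul (z ^ 2 / 4), mul_pow (-1) (z ^ 2 / 4), div_eq_mul_inv]
  ring

/-- Reflection at negative integer orders. -/
lemma besselEntire_neg_natCast (p : ℕ) (z : ℂ) :
    besselEntire (-(p : ℂ)) z = (-(z ^ 2 / 4)) ^ p * besselEntire p z := by
  rw [besselEntire, besselEntire]
  set w := -(z ^ 2 / 4)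
  have h1 := (hasSum_cliffordC (p : ℂ) w).mul_left (w ^ p)
  refine (hasSum_cliffordC (-(p : ℂ)) w).unique ?_
  rw [← hasSum_nat_add_iff' p]
  -- The first p coefficients sit at poles of Γ, where `Complex.Gamma` and hence its inverse are 0.
  have h0 : ∑ i ∈ Finset.range p, cliffordCoeff (-(p : ℂ)) i * w ^ i = 0 := by
    refine Finset.sum_eq_zero fun i hi => ?_
    have hi' : i + 1 ≤ p := Finset.mem_range.1 hi
    obtain ⟨d, rfl⟩ := Nat.exists_eq_add_of_le hi'
    rw [cliffordCoeff, show (i : ℂ) + -((i + 1 + d : ℕ) : ℂ) + 1 = -(d : ℂ) by push_cast; ring,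
      Complex.Gamma_neg_nat_eq_zero]
    simp
  rw [h0, sub_zero]
  convert! h1 using 2 with n
  have : cliffordCoeff (-(p : ℂ)) (n + p) = cliffordCoeff p n := by
    rw [cliffordCoeff, cliffordCoeff,
      show ((n + p : ℕ) : ℂ) + -(p : ℂ) + 1 = n + 1 by push_cast; ring,
      show (n : ℂ) + p + 1 = (n + p : ℕ) + 1 by push_cast; ring,
      Complex.Gamma_nat_eq_factorial, Complex.Gamma_nat_eq_factorial, mul_comm]
  rw [this]; ring

/-! ### Asymptotics of a single Bessel function at infinity -/

/-- A differential inequality `‖W'‖ ≤ K t⁻² ‖W‖` forces convergence at infinity at rate `1 / t`. -/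
lemma exists_norm_sub_le_div_of_norm_deriv_le {E : Type*} [NormedAddCommGroup E] [NormedSpace ℝ E]
    [CompleteSpace E] {W W' : ℝ → E} {K : ℝ}
    (hW : ∀ t, 1 ≤ t → HasDerivAt W (W' t) t)
    (hK : ∀ t, 1 ≤ t → ‖W' t‖ ≤ K / t ^ 2 * ‖W t‖) :
    ∃ (L : E) (C : ℝ), ∀ t, 1 ≤ t → ‖W t - L‖ ≤ C / t := by
  -- The substitution t = 1/(1-s) maps [0,1) onto [1,∞) and turns the weight K/t² into the constant
  -- K. Grönwall then bounds V, so V is Lipschitz; since s = 1 - 1/t, this is the Cauchy property at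
  -- rate 1/t.
  set V : ℝ → E := fun s => W (1 - s)⁻¹
  set V' : ℝ → E := fun s => ((1 - s)⁻¹ ^ 2) • W' (1 - s)⁻¹
  have hone : ∀ s : ℝ, 0 ≤ s → s < 1 → 1 ≤ (1 - s)⁻¹ := fun s h0 h1 =>
    (one_le_inv₀ (by linarith)).2 (by linarith)
  have hV : ∀ s, 0 ≤ s → s < 1 → HasDerivAt V (V' s) s := by
    intro s h0 h1
    have h2 : HasDerivAt (fun s : ℝ => (1 - s)⁻¹) ((1 - s)⁻¹ ^ 2) s := by
      convert! ((hasDerivAt_id s).const_sub 1).inv (by simp; linarith) using 1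
      simp
    exact (hW _ (hone s h0 h1)).scomp s h2
  have hV' : ∀ s, 0 ≤ s → s < 1 → ‖V' s‖ ≤ K * ‖V s‖ := by
    intro s h0 h1
    have h2 := hK _ (hone s h0 h1)
    have h3 : 0 < (1 - s)⁻¹ := inv_pos.2 (by linarith)
    rw [norm_smul, Real.norm_of_nonneg (by positivity)]
    calc _ ≤ (1 - s)⁻¹ ^ 2 * (K / (1 - s)⁻¹ ^ 2 * ‖V s‖) := by gcongr
      _ = K * ‖V s‖ := by
        have h4 : (1 - s)⁻¹ ^ 2 ≠ 0 := by positivity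
        rw [← mul_assoc, mul_div_cancel₀ _ h4]
  have hbound : ∀ s, 0 ≤ s → s < 1 → ‖V s‖ ≤ ‖W 1‖ * Real.exp |K| := by
    intro s h0 h1
    have hg := norm_le_gronwallBound_of_norm_deriv_right_le (f := V) (f' := V') (δ := ‖W 1‖)
      (K := K) (ε := 0) (a := 0) (b := s)
      (fun x hx => (hV x hx.1 (hx.2.trans_lt h1)).continuousAt.continuousWithinAt)
      (fun x hx => (hV x hx.1 (hx.2.trans h1)).hasDerivWithinAt) (by simp [V])
      (fun x hx => by simpa using hV' x hx.1 (hx.2.trans h1)) s ⟨h0, le_rfl⟩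
    rw [gronwallBound_ε0, sub_zero] at hg
    refine hg.trans (mul_le_mul_of_nonneg_left (Real.exp_le_exp.2 ?_) (norm_nonneg _))
    calc K * s ≤ |K| * s := by gcongr; exact le_abs_self K
      _ ≤ |K| := mul_le_of_le_one_right (abs_nonneg _) h1.le
  set C : ℝ := |K| * (‖W 1‖ * Real.exp |K|)
  have hC : 0 ≤ C := by positivity
  have hlip : ∀ s t, 0 ≤ s → s ≤ t → t < 1 → ‖V t - V s‖ ≤ C * (t - s) := by
    intro s t h0 hst h1
    refine norm_image_sub_le_of_norm_deriv_le_segment' (f := V) (f' := V')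
      (fun x hx => (hV x (h0.trans hx.1) (hx.2.trans_lt h1)).hasDerivWithinAt)
      (fun x hx => ?_) t ⟨hst, le_rfl⟩
    have hx0 := h0.trans hx.1
    have hx1 := hx.2.trans h1
    calc ‖V' x‖ ≤ K * ‖V x‖ := hV' x hx0 hx1
      _ ≤ |K| * ‖V x‖ := by gcongr; exact le_abs_self K
      _ ≤ C := mul_le_mul_of_nonneg_left (hbound x hx0 hx1) (abs_nonneg K)
  have hWlip : ∀ s t, 1 ≤ s → s ≤ t → ‖W t - W s‖ ≤ C / s := by
    intro s t hs hst
    have hs0 : 0 < s := by linarith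
    have ht0 : 0 < t := by linarith
    have h1 := hlip (1 - s⁻¹) (1 - t⁻¹) (by simpa using inv_le_one_of_one_le₀ hs)
      (by gcongr) (by simpa using ht0)
    simp only [V, sub_sub_cancel, inv_inv] at h1
    refine h1.trans ?_
    rw [div_eq_mul_inv]
    gcongr
    have := inv_pos.2 ht0
    linarith
  have hcauchy : CauchySeq fun n : ℕ => W (n + 1) := by
    refine cauchySeq_of_le_tendsto_0' (fun n : ℕ => C / ((n : ℝ) + 1)) (fun n m hnm => ?_) ?_
    · rw [dist_comm, dist_eq_norm]
      exact hWlip _ _ (by simp) (by gcongr)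
    · have := (tendsto_one_div_add_atTop_nhds_zero_nat (𝕜 := ℝ)).const_mul C
      simpa [div_eq_mul_inv] using this
  obtain ⟨L, hL⟩ := cauchySeq_tendsto_of_complete hcauchy
  refine ⟨L, C, fun t ht => ?_⟩
  rw [norm_sub_rev]
  refine le_of_tendsto (hL.sub_const (W t)).norm ?_
  filter_upwards [eventually_ge_atTop ⌈t⌉₊] with n hn
  refine hWlip _ _ ht ?_
  have := (Nat.le_ceil t).trans (Nat.cast_le.2 hn)
  linarith

open Complex in
-- The function u, a multiple of √t J_ν(t), solves u'' = (q/t² - 1) u with q = ν² - 1/4, a small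
-- perturbation of u'' = -u. Variation of constants, W = (e^{-it}(u' + iu), e^{it}(u' - iu)),
-- cancels the main term and leaves ‖W'‖ ≤ |q| t⁻² ‖W‖; the limit of W supplies A and B.
lemma exists_norm_besselEntire_sub_le (ν : ℂ) :
    ∃ (A B : ℂ) (C : ℝ), ∀ t : ℝ, 1 ≤ t →
      ‖(t : ℂ) ^ (ν + 1 / 2) * besselEntire ν t - (A * exp (I * t) + B * exp (-(I * t)))‖
        ≤ C / t := by
  set u : ℝ → ℂ := fun t => (t : ℂ) ^ (ν + 1 / 2) * besselEntire ν t
  set v : ℝ → ℂ := fun t => (t : ℂ) ^ (ν + 1 / 2) *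
    ((ν + 1 / 2) / t * besselEntire ν t - t / 2 * besselEntire (ν + 1) t)
  set q : ℂ := ν ^ 2 - 1 / 4
  have hcpow : ∀ t : ℝ, 1 ≤ t → HasDerivAt (fun t : ℝ => (t : ℂ) ^ (ν + 1 / 2))
      ((t : ℂ) ^ (ν + 1 / 2) * ((ν + 1 / 2) / t)) t := by
    intro t ht
    have ht0 : (t : ℂ) ≠ 0 := by exact_mod_cast (by linarith : t ≠ 0)
    have := ((hasDerivAt_id (t : ℂ)).cpow_const (c := ν + 1 / 2)
      (by simp only [id]; exact Or.inl (by simp; linarith))).comp_ofReal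
    convert! this using 1
    simp only [id, mul_one]
    rw [cpow_sub _ _ ht0, cpow_one]; ring
  have hof : ∀ t : ℝ, HasDerivAt (fun t : ℝ => (t : ℂ)) 1 t := fun t =>
    (hasDerivAt_id (t : ℂ)).comp_ofReal
  have hu : ∀ t : ℝ, 1 ≤ t → HasDerivAt u (v t) t := by
    intro t ht
    convert! (hcpow t ht).mul (hasDerivAt_besselEntire ν t).comp_ofReal using 1
    simp only [v]; ring
  have hv : ∀ t : ℝ, 1 ≤ t → HasDerivAt v (q / t ^ 2 * u t - u t) t := by
    intro t ht
    have ht0 : (t : ℂ) ≠ 0 := by exact_mod_cast (by linarith : t ≠ 0)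
    have h1 := ((hasDerivAt_const t (ν + 1 / 2)).div (hof t) ht0).mul
      (hasDerivAt_besselEntire ν t).comp_ofReal
    have h2 := ((hof t).div_const 2).mul (hasDerivAt_besselEntire (ν + 1) t).comp_ofReal
    convert! (hcpow t ht).mul (h1.sub h2) using 1
    simp only [u, q, Pi.mul_apply, Pi.sub_apply, Pi.div_apply]
    have h3 := besselEntire_recurrence ν t
    rw [show ν + 1 + 1 = ν + 2 by ring, h3]
    field_simp
    ring
  set W : ℝ → ℂ × ℂ := fun t =>
    (exp (-(I * t)) * (v t + I * u t), exp (I * t) * (v t - I * u t))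
  set W' : ℝ → ℂ × ℂ := fun t =>
    (exp (-(I * t)) * (q / t ^ 2 * u t), exp (I * t) * (q / t ^ 2 * u t))
  have he1 : ∀ t : ℝ, ‖exp (I * t)‖ = 1 := fun t => by
    rw [mul_comm]; exact norm_exp_ofReal_mul_I t
  have he2 : ∀ t : ℝ, ‖exp (-(I * t))‖ = 1 := fun t => by
    rw [show -(I * (t : ℂ)) = ((-t : ℝ) : ℂ) * I by push_cast; ring]
    exact norm_exp_ofReal_mul_I _
  have hee : ∀ t : ℝ, exp (I * t) * exp (-(I * t)) = 1 := fun t => by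
    rw [← exp_add]; simp
  have hWd : ∀ t : ℝ, 1 ≤ t → HasDerivAt W (W' t) t := by
    intro t ht
    have hI1 : HasDerivAt (fun t : ℝ => I * (t : ℂ)) I t := by
      simpa using (hof t).const_mul I
    have h1 := (hI1.neg.cexp).mul ((hv t ht).add ((hu t ht).const_mul I))
    have h2 := (hI1.cexp).mul ((hv t ht).sub ((hu t ht).const_mul I))
    refine HasDerivAt.prodMk ?_ ?_
    · convert! h1 using 1
      simp only [Pi.neg_apply, Pi.add_apply]
      linear_combination (exp (-(I * (t : ℂ))) * u t) * I_mul_I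
    · convert! h2 using 1
      simp only [Pi.sub_apply]
      linear_combination (exp (I * (t : ℂ)) * u t) * I_mul_I
  have huW : ∀ t : ℝ, u t = (exp (I * t) * (W t).1 - exp (-(I * t)) * (W t).2) / (2 * I) := by
    intro t
    rw [eq_div_iff (by simp)]
    simp only [W]
    linear_combination (-2 * I * u t) * hee t
  have hle : ∀ (t : ℝ) (a b : ℂ), ‖exp (I * t) * a - exp (-(I * t)) * b‖ ≤ ‖a‖ + ‖b‖ := by
    intro t a b
    refine (norm_sub_le _ _).trans ?_
    rw [norm_mul, norm_mul, he1, he2, one_mul, one_mul]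
  have hnorm : ∀ t : ℝ, ‖u t‖ ≤ ‖W t‖ := by
    intro t
    rw [huW, norm_div, norm_mul, norm_I, mul_one, Complex.norm_two, div_le_iff₀ two_pos]
    linarith [hle t (W t).1 (W t).2, norm_fst_le (W t), norm_snd_le (W t)]
  have hWK : ∀ t : ℝ, 1 ≤ t → ‖W' t‖ ≤ ‖q‖ / t ^ 2 * ‖W t‖ := by
    intro t ht
    have h1 : ‖q / (t : ℂ) ^ 2 * u t‖ ≤ ‖q‖ / t ^ 2 * ‖W t‖ := by
      rw [norm_mul, norm_div, norm_pow, norm_real, Real.norm_eq_abs, sq_abs]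
      gcongr
      exact hnorm t
    refine norm_prod_le_iff.2 ⟨?_, ?_⟩
    · simp only [W']; rw [norm_mul, he2, one_mul]; exact h1
    · simp only [W']; rw [norm_mul, he1, one_mul]; exact h1
  obtain ⟨L, C, hL⟩ := exists_norm_sub_le_div_of_norm_deriv_le hWd hWK
  refine ⟨L.1 / (2 * I), -L.2 / (2 * I), C, fun t ht => ?_⟩
  have h1 := hL t ht
  change ‖u t - _‖ ≤ _
  have h2 : u t - (L.1 / (2 * I) * exp (I * t) + -L.2 / (2 * I) * exp (-(I * t))) =
      (exp (I * t) * (W t - L).1 - exp (-(I * t)) * (W t - L).2) / (2 * I) := by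
    rw [huW, Prod.fst_sub, Prod.snd_sub]; ring
  rw [h2, norm_div, norm_mul, norm_I, mul_one, Complex.norm_two, div_le_iff₀ two_pos]
  linarith [hle t (W t - L).1 (W t - L).2, norm_fst_le (W t - L), norm_snd_le (W t - L)]

/-! ### Asymptotics of the product and oscillating integrals -/

/-- The entire function `z^{2K} ∏ⱼ gⱼ(aⱼ z)`, with `gⱼ` the even entire function attached to
`J_{νⱼ}`. -/
noncomputable def besselEntireProduct {N : ℕ} (K : ℕ) (ν : Fin N → ℂ) (a : Fin N → ℝ) (z : ℂ) : ℂ :=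
  z ^ (2 * K) * ∏ j, besselEntire (ν j) ((a j : ℂ) * z)

section Asymptotics
open Asymptotics Complex

lemma norm_exp_I_mul_ofReal_mul (c t : ℝ) : ‖exp (I * c * t)‖ = 1 := by
  rw [show I * (c : ℂ) * t = ((c * t : ℝ) : ℂ) * I by push_cast; ring]
  exact norm_exp_ofReal_mul_I _

lemma isBigO_besselEntire_of_pos (ν : ℂ) {a : ℝ} (ha : 0 < a) :
    ∃ A B : ℂ, (fun t : ℝ => (t : ℂ) ^ (ν + 1 / 2) * besselEntire ν (a * t)
      - (A * exp (I * a * t) + B * exp (I * (-a : ℝ) * t))) =O[atTop] fun t : ℝ => t⁻¹ := by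
  obtain ⟨A, B, C, h⟩ := exists_norm_besselEntire_sub_le ν
  have ha0 : (a : ℂ) ^ (ν + 1 / 2) ≠ 0 := by
    simp [cpow_eq_zero_iff, ha.ne']
  set p := (a : ℂ) ^ (ν + 1 / 2)
  refine ⟨p⁻¹ * A, p⁻¹ * B, IsBigO.of_bound (‖p⁻¹‖ * (C / a)) ?_⟩
  filter_upwards [eventually_ge_atTop a⁻¹, eventually_gt_atTop 0] with t ht ht0
  have h1 := h (a * t) (by rwa [inv_le_iff_one_le_mul₀' ha] at ht)
  have h2 : (t : ℂ) ^ (ν + 1 / 2) * besselEntire ν (a * t)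
      - (p⁻¹ * A * exp (I * a * t) + p⁻¹ * B * exp (I * (-a : ℝ) * t))
      = p⁻¹ * (((a * t : ℝ) : ℂ) ^ (ν + 1 / 2) * besselEntire ν (a * t : ℝ) -
        (A * exp (I * (a * t : ℝ)) + B * exp (-(I * (a * t : ℝ))))) := by
    rw [ofReal_mul, mul_cpow_ofReal_nonneg ha.le ht0.le]
    change _ = p⁻¹ * (p * _ * _ - _)
    rw [ofReal_neg, mul_sub, mul_assoc p, inv_mul_cancel_left₀ ha0,
      show I * -(a : ℂ) * t = -(I * (a * t)) by ring, show I * (a : ℂ) * t = I * (a * t) by ring]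
    ring
  rw [h2, norm_mul, norm_inv t, Real.norm_of_nonneg ht0.le, mul_assoc]
  gcongr
  refine h1.trans_eq ?_
  field_simp

lemma isBigO_besselEntire (ν : ℂ) {a : ℝ} (ha : a ≠ 0) :
    ∃ C : ℝ → ℂ, (fun t : ℝ => (t : ℂ) ^ (ν + 1 / 2) * besselEntire ν (a * t)
      - ∑ s ∈ ({1, -1} : Finset ℝ), C s * exp (I * (s * a : ℝ) * t)) =O[atTop]
        fun t : ℝ => t⁻¹ := by
  have hne : (1 : ℝ) ≠ -1 := by norm_num
  rcases ha.lt_or_gt with h | h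
  · obtain ⟨A, B, hAB⟩ := isBigO_besselEntire_of_pos ν (neg_pos.2 h)
    refine ⟨fun s => if s = 1 then B else A, ?_⟩
    convert hAB using 2 with t
    rw [Finset.sum_pair hne]
    have : besselEntire ν (((-a : ℝ) : ℂ) * t) = besselEntire ν (a * t) := by
      rw [← besselEntire_neg]; congr 1; push_cast; ring
    rw [this]
    simp [hne.symm, add_comm]
  · obtain ⟨A, B, hAB⟩ := isBigO_besselEntire_of_pos ν h
    refine ⟨fun s => if s = 1 then A else B, ?_⟩
    convert hAB using 2 with t
    rw [Finset.sum_pair hne]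
    simp [hne.symm]

lemma isBigO_prod_sub_prod {ι : Type*} (s : Finset ι) (f g : ι → ℝ → ℂ)
    (h : ∀ i ∈ s, (fun t => f i t - g i t) =O[atTop] fun t : ℝ => t⁻¹)
    (hg : ∀ i ∈ s, (g i) =O[atTop] fun _ => (1 : ℝ)) :
    (fun t => ∏ i ∈ s, f i t - ∏ i ∈ s, g i t) =O[atTop] (fun t : ℝ => t⁻¹) ∧
      (fun t => ∏ i ∈ s, g i t) =O[atTop] fun _ => (1 : ℝ) := by
  classical
  induction s using Finset.induction_on with
  | empty => exact ⟨by simpa using isBigO_zero _ _, IsBigO.of_bound 1 (by simp)⟩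
  | insert i s hi ih =>
    obtain ⟨ih1, ih2⟩ := ih (fun j hj => h j (Finset.mem_insert_of_mem hj))
      (fun j hj => hg j (Finset.mem_insert_of_mem hj))
    have hi1 := h i (Finset.mem_insert_self _ _)
    have hi2 := hg i (Finset.mem_insert_self _ _)
    have hinv : (fun t : ℝ => t⁻¹) =O[atTop] fun _ => (1 : ℝ) :=
      tendsto_inv_atTop_zero.isBigO_one ℝ
    have hf : (f i) =O[atTop] fun _ => (1 : ℝ) := by
      simpa using (hi1.trans hinv).add hi2
    simp only [Finset.prod_insert hi]
    refine ⟨?_, by simpa using hi2.mul ih2⟩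
    have := ((hf.mul ih1).congr_right fun t => one_mul t⁻¹).add
      ((hi1.mul ih2).congr_right fun t => mul_one t⁻¹)
    convert! this using 2 with t
    ring

/-- Multiplying out the two-term asymptotics of the factors gives one exponential for each choice of
signs; its frequency is the signed sum of the a_j. -/
lemma isBigO_besselEntireProduct {N : ℕ} (K : ℕ) (ν : Fin N → ℂ) (a : Fin N → ℝ)
    (ha : ∀ j, a j ≠ 0) :
    ∃ D : (Fin N → ℝ) → ℂ, (fun t : ℝ => (t : ℂ) ^ (∑ j, (ν j + 1 / 2) - (2 * K : ℕ))
        * besselEntireProduct K ν a t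
      - ∑ p ∈ Fintype.piFinset fun _ : Fin N => ({1, -1} : Finset ℝ),
          D p * exp (I * (∑ j, p j * a j : ℝ) * t)) =O[atTop] fun t : ℝ => t⁻¹ := by
  choose C hC using fun j => isBigO_besselEntire (ν j) (ha j)
  refine ⟨fun p => ∏ j, C j (p j), ?_⟩
  have hg : ∀ j ∈ Finset.univ, (fun t : ℝ => ∑ s ∈ ({1, -1} : Finset ℝ),
      C j s * exp (I * (s * a j : ℝ) * t)) =O[atTop] fun _ => (1 : ℝ) := by
    intro j _
    refine IsBigO.fun_sum fun s _ => ?_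
    refine IsBigO.of_bound ‖C j s‖ (Eventually.of_forall fun t => ?_)
    rw [norm_mul, norm_exp_I_mul_ofReal_mul]; simp
  have h := (isBigO_prod_sub_prod Finset.univ _ _ (fun j _ => hC j) hg).1
  refine h.congr' ?_ EventuallyEq.rfl
  filter_upwards [eventually_gt_atTop 0] with t ht
  have ht' : (t : ℂ) ≠ 0 := by exact_mod_cast ht.ne'
  congr 1
  · rw [besselEntireProduct, Finset.prod_mul_distrib, cpow_sub _ _ ht', cpow_natCast, ← mul_assoc,
      div_mul_cancel₀ _ (pow_ne_zero _ ht')]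
    congr 1
    simp only [cpow_def_of_ne_zero ht', Finset.mul_sum, exp_sum]
  · rw [Finset.prod_univ_sum]
    refine Finset.sum_congr rfl fun p _ => ?_
    rw [Finset.prod_mul_distrib, ← exp_sum]
    push_cast
    rw [Finset.mul_sum, Finset.sum_mul]

lemma norm_ofReal_cpow_neg {t : ℝ} (ht : 0 < t) (μ : ℂ) : ‖(t : ℂ) ^ (-μ)‖ = t ^ (-μ.re) := by
  rw [norm_cpow_eq_rpow_re_of_pos ht, neg_re]

lemma integrableOn_Ici_one_of_isBigO {f : ℝ → ℂ} (hf : ContinuousOn f (Set.Ici 1)) {s : ℝ}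
    (hs : 1 < s) (h : f =O[atTop] fun t : ℝ => t ^ (-s)) : IntegrableOn f (Set.Ici 1) :=
  (hf.locallyIntegrableOn measurableSet_Ici).integrableOn_of_isBigO_atTop h
    (integrableAtFilter_rpow_atTop_iff.2 (by linarith))

lemma continuousOn_cpow_mul_exp (μ : ℂ) (c : ℝ) :
    ContinuousOn (fun t : ℝ => (t : ℂ) ^ μ * exp (I * c * t)) (Set.Ici 1) := by
  refine ContinuousOn.mul (fun t ht => ?_) (by fun_prop)
  exact (continuousAt_ofReal_cpow_const _ _
    (Or.inr (zero_lt_one.trans_le ht).ne')).continuousWithinAt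

lemma exists_tendsto_integral_of_integrableOn {f : ℝ → ℂ} (hf : IntegrableOn f (Set.Ici 1)) :
    ∃ I : ℂ, Tendsto (fun T => ∫ t in (1 : ℝ)..T, f t) atTop (𝓝 I) :=
  ⟨_, intervalIntegral_tendsto_integral_Ioi 1 (hf.mono_set Set.Ioi_subset_Ici_self) tendsto_id⟩

/-- One integration by parts gains a factor 1/t: the boundary term Φ tends to 0 and the remaining
integral converges absolutely. -/
lemma exists_tendsto_integral_cpow_mul_exp {μ : ℂ} (hμ : 0 < μ.re) {c : ℝ} (hc : c ≠ 0) :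
    ∃ J : ℂ, Tendsto (fun T : ℝ => ∫ t in (1 : ℝ)..T, (t : ℂ) ^ (-μ) * exp (I * c * t)) atTop
      (𝓝 J) := by
  have hc' : I * (c : ℂ) ≠ 0 := mul_ne_zero I_ne_zero (by exact_mod_cast hc)
  have hcont := continuousOn_cpow_mul_exp (-μ) c
  have hcont1 := continuousOn_cpow_mul_exp (-(μ + 1)) c
  have hO : ∀ ρ : ℂ, (fun t : ℝ => (t : ℂ) ^ (-ρ) * exp (I * c * t)) =O[atTop]
      fun t : ℝ => t ^ (-ρ.re) := by
    intro ρ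
    refine IsBigO.of_bound 1 ?_
    filter_upwards [eventually_gt_atTop 0] with t ht
    rw [norm_mul, norm_exp_I_mul_ofReal_mul, norm_ofReal_cpow_neg ht, one_mul, mul_one,
      Real.norm_of_nonneg (by positivity)]
  obtain ⟨J, hJ⟩ := exists_tendsto_integral_of_integrableOn
    (integrableOn_Ici_one_of_isBigO hcont1 (s := (μ + 1).re) (by simpa using hμ) (hO _))
  set Φ : ℝ → ℂ := fun t => (t : ℂ) ^ (-μ) * exp (I * c * t) / (I * c)
  have hΦ : ∀ t : ℝ, 1 ≤ t → HasDerivAt Φ ((t : ℂ) ^ (-μ) * exp (I * c * t)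
      - μ / (I * c) * ((t : ℂ) ^ (-(μ + 1)) * exp (I * c * t))) t := by
    intro t ht
    have h1 := ((hasDerivAt_id (t : ℂ)).cpow_const (c := -μ)
      (by simp only [id]; exact Or.inl (by simp; linarith))).comp_ofReal
    have h2 : HasDerivAt (fun t : ℝ => exp (I * c * t)) (exp (I * c * t) * (I * c)) t := by
      have := ((hasDerivAt_id (t : ℂ)).const_mul (I * (c : ℂ))).cexp.comp_ofReal
      simpa using this
    convert! (h1.mul h2).div_const (I * c) using 1
    simp only [id, mul_one]
    rw [show -(μ + 1) = -μ - 1 by ring]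
    have hc1 : (c : ℂ) ≠ 0 := by exact_mod_cast hc
    field_simp
    ring
  have hΦ0 : Tendsto Φ atTop (𝓝 0) := by
    have h1 := (hO μ).trans_tendsto (tendsto_rpow_neg_atTop hμ)
    simpa using h1.div_const (I * c)
  refine ⟨0 - Φ 1 + μ / (I * c) * J, ((hΦ0.sub_const _).add (hJ.const_mul _)).congr' ?_⟩
  filter_upwards [eventually_ge_atTop 1] with T hT
  have hsub : Set.uIcc 1 T ⊆ Set.Ici 1 := by
    rw [Set.uIcc_of_le hT]; exact Set.Icc_subset_Ici_self
  have hi := (hcont.mono hsub).intervalIntegrable (μ := volume)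
  have hi1 := ((hcont1.mono hsub).intervalIntegrable (μ := volume)).const_mul (μ / (I * c))
  rw [← intervalIntegral.integral_eq_sub_of_hasDerivAt (fun t ht => hΦ t (hsub ht)) (hi.sub hi1),
    intervalIntegral.integral_sub hi hi1, intervalIntegral.integral_const_mul]
  ring

lemma isBigO_of_isBigO_cpow_mul {F : ℝ → ℂ} {μ : ℂ} {r : ℝ → ℝ}
    (h : (fun t : ℝ => (t : ℂ) ^ μ * F t) =O[atTop] r) :
    F =O[atTop] fun t : ℝ => t ^ (-μ.re) * r t := by
  have h1 : (fun t : ℝ => (t : ℂ) ^ (-μ)) =O[atTop] fun t : ℝ => t ^ (-μ.re) := by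
    refine IsBigO.of_bound 1 ?_
    filter_upwards [eventually_gt_atTop 0] with t ht
    rw [norm_ofReal_cpow_neg ht, one_mul, Real.norm_of_nonneg (by positivity)]
  refine (h1.mul h).congr' ?_ EventuallyEq.rfl
  filter_upwards [eventually_gt_atTop 0] with t ht
  have ht' : (t : ℂ) ≠ 0 := by exact_mod_cast ht.ne'
  rw [← mul_assoc, ← cpow_add _ _ ht']; simp

/-- The leading terms converge conditionally because no frequency vanishes; the remainder is
O(t^{-(Re μ + 1)}), hence integrable. -/
lemma exists_tendsto_integral_of_oscillating {F : ℝ → ℂ} (hF : ContinuousOn F (Set.Ici 1)) {μ : ℂ}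
    (hμ : 0 < μ.re) {ι : Type*} (S : Finset ι) (D : ι → ℂ) (c : ι → ℝ) (hc : ∀ p ∈ S, c p ≠ 0)
    (h : (fun t : ℝ => (t : ℂ) ^ μ * F t - ∑ p ∈ S, D p * exp (I * c p * t)) =O[atTop]
      fun t : ℝ => t⁻¹) :
    ∃ J : ℂ, Tendsto (fun T => ∫ t in (1 : ℝ)..T, F t) atTop (𝓝 J) := by
  have hosc : ∃ J : ℂ, Tendsto (fun T : ℝ => ∑ p ∈ S,
      D p * ∫ t in (1 : ℝ)..T, (t : ℂ) ^ (-μ) * exp (I * c p * t)) atTop (𝓝 J) := by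
    have h1 : ∀ p, ∃ J : ℂ, p ∈ S → Tendsto (fun T : ℝ =>
        ∫ t in (1 : ℝ)..T, (t : ℂ) ^ (-μ) * exp (I * c p * t)) atTop (𝓝 J) := by
      intro p
      by_cases hp : p ∈ S
      · obtain ⟨J, hJ⟩ := exists_tendsto_integral_cpow_mul_exp hμ (hc p hp)
        exact ⟨J, fun _ => hJ⟩
      · exact ⟨0, fun h => absurd h hp⟩
    choose J hJ using h1
    exact ⟨_, tendsto_finsetSum S fun p hp => (hJ p hp).const_mul (D p)⟩
  obtain ⟨J, hJ⟩ := hosc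
  set P : ℝ → ℂ := fun t => ∑ p ∈ S, D p * ((t : ℂ) ^ (-μ) * exp (I * c p * t))
  have hPc : ContinuousOn P (Set.Ici 1) :=
    continuousOn_finsetSum S fun p _ => continuousOn_const.mul (continuousOn_cpow_mul_exp _ _)
  have hrem : (fun t : ℝ => F t - P t) =O[atTop] fun t : ℝ => t ^ (-(μ.re + 1)) := by
    have h2 : (fun t : ℝ => (t : ℂ) ^ μ * (F t - P t)) =O[atTop] fun t : ℝ => t⁻¹ := by
      refine h.congr' ?_ EventuallyEq.rfl
      filter_upwards [eventually_gt_atTop 0] with t ht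
      have ht' : (t : ℂ) ≠ 0 := by exact_mod_cast ht.ne'
      rw [mul_sub, Finset.mul_sum]
      congr 1
      refine Finset.sum_congr rfl fun p _ => ?_
      have h3 : (t : ℂ) ^ μ * (t : ℂ) ^ (-μ) = 1 := by rw [← cpow_add _ _ ht']; simp
      linear_combination (-D p * exp (I * c p * t)) * h3
    refine (isBigO_of_isBigO_cpow_mul h2).congr' EventuallyEq.rfl ?_
    filter_upwards [eventually_gt_atTop 0] with t ht
    rw [neg_add, Real.rpow_add ht, Real.rpow_neg_one]
  obtain ⟨J', hJ'⟩ := exists_tendsto_integral_of_integrableOn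
    (integrableOn_Ici_one_of_isBigO (f := fun t => F t - P t) (hF.sub hPc) (by linarith) hrem)
  refine ⟨J' + J, (hJ'.add hJ).congr' ?_⟩
  filter_upwards [eventually_ge_atTop 1] with T hT
  have hsub : Set.uIcc 1 T ⊆ Set.Ici 1 := by
    rw [Set.uIcc_of_le hT]; exact Set.Icc_subset_Ici_self
  have hiF := (hF.mono hsub).intervalIntegrable (μ := volume)
  have hiP := (hPc.mono hsub).intervalIntegrable (μ := volume)
  have hP : ∫ t in (1 : ℝ)..T, P t = ∑ p ∈ S,
      D p * ∫ t in (1 : ℝ)..T, (t : ℂ) ^ (-μ) * exp (I * c p * t) := by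
    simp only [P]
    rw [intervalIntegral.integral_finsetSum fun p _ =>
      (((continuousOn_cpow_mul_exp (-μ) (c p)).mono hsub).intervalIntegrable).const_mul (D p)]
    simp only [intervalIntegral.integral_const_mul]
  rw [← hP, intervalIntegral.integral_sub hiF hiP]
  ring

end Asymptotics

/-! ### Decay off the real axis by Phragmén–Lindelöf -/

section PhragmenLindelof
open Complex Asymptotics

/-- An even entire function of exponential type that decays like `|x|^{-δ}` on the real line decays
at the same rate on horizontal lines, with a constant exponential in the height. -/
lemma norm_mul_max_rpow_le_of_even {F : ℂ → ℂ} (hF : Differentiable ℂ F)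
    (heven : ∀ z, F (-z) = F z) {C C₁ σ τ δ : ℝ} (hσ : 0 ≤ σ) (hστ : σ < τ) (hδ : 0 ≤ δ)
    (hC : 0 ≤ C) (hgrowth : ∀ z, ‖F z‖ ≤ C * Real.exp (σ * ‖z‖))
    (hreal : ∀ x : ℝ, ‖F x‖ * ‖1 + x * I‖ ^ δ ≤ C₁) (x y : ℝ) :
    ‖F (x + y * I)‖ * max 1 |x| ^ δ ≤ C₁ * Real.exp (τ * |y|) := by
  wlog hy : 0 ≤ y generalizing x y
  · have h := this (-x) (-y) (by linarith)
    have e : ((-x : ℝ) : ℂ) + ((-y : ℝ) : ℂ) * I = -(x + y * I) := by push_cast; ring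
    rwa [e, heven, abs_neg, abs_neg] at h
  -- With z = iw the upper half plane becomes the right one. The power offsets the decay of F, so f
  -- is bounded by C₁ on the imaginary axis; the exponential, with τ > σ, makes f bounded on the
  -- positive real axis.
  set f : ℂ → ℂ := fun w => F (I * w) * (1 + w) ^ (δ : ℂ) * exp (-τ * w)
  have hslit : ∀ w : ℂ, 0 ≤ w.re → 1 + w ∈ slitPlane := fun w hw => Or.inl (by simp; linarith)
  have hfn : ∀ w : ℂ, 0 ≤ w.re →
      ‖f w‖ = ‖F (I * w)‖ * ‖1 + w‖ ^ δ * Real.exp (-τ * w.re) := by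
    intro w hw
    have h0 : 1 + w ≠ 0 := slitPlane_ne_zero (hslit w hw)
    simp only [f]
    rw [norm_mul, norm_mul, norm_exp, norm_cpow_of_ne_zero h0]
    simp
  have hbound : ∀ w : ℂ, 0 ≤ w.re →
      ‖f w‖ ≤ C * Real.exp (σ * ‖w‖) * ‖1 + w‖ ^ δ * Real.exp (-τ * w.re) := by
    intro w hw
    rw [hfn w hw]
    gcongr
    simpa using hgrowth (I * w)
  have hd : DiffContOnCl ℂ f {z | 0 < z.re} := by
    apply DifferentiableOn.diffContOnCl
    rw [closure_setOfPred_lt_re]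
    intro w hw
    refine DifferentiableAt.differentiableWithinAt ?_
    refine DifferentiableAt.mul (DifferentiableAt.mul ?_ ?_) (by fun_prop)
    · exact hF.differentiableAt.comp w (by fun_prop)
    · exact DifferentiableAt.cpow_const (by fun_prop) (hslit w hw)
  have key : ∀ w : ℂ, 0 ≤ w.re → ‖f w‖ ≤ C₁ := by
    intro w hw
    refine PhragmenLindelof.right_half_plane_of_bounded_on_real hd
      ⟨1, by norm_num, σ + δ, IsBigO.of_bound C ?_⟩ ?_ ?_ hw
    · filter_upwards [mem_inf_of_right (mem_principal_self _)] with z (hz : 0 < z.re)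
      refine (hbound z hz.le).trans ?_
      have h1 : ‖1 + z‖ ^ δ ≤ Real.exp (δ * ‖z‖) := by
        rw [mul_comm, Real.exp_mul]
        gcongr
        calc ‖1 + z‖ ≤ 1 + ‖z‖ := by simpa using norm_add_le 1 z
          _ ≤ Real.exp ‖z‖ := by linarith [Real.add_one_le_exp ‖z‖]
      have h2 : Real.exp (-τ * z.re) ≤ 1 := Real.exp_le_one_iff.2 (by nlinarith)
      rw [Real.norm_of_nonneg (Real.exp_pos _).le, Real.rpow_one, add_mul, Real.exp_add]
      calc _ ≤ C * Real.exp (σ * ‖z‖) * Real.exp (δ * ‖z‖) * 1 := by gcongr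
        _ = _ := by ring
    · have hlim : Tendsto (fun x : ℝ => C * ((1 + x) ^ δ * Real.exp (-(τ - σ) * (1 + x)) *
          Real.exp (τ - σ))) atTop (𝓝 (C * (0 * Real.exp (τ - σ)))) :=
        (((tendsto_rpow_mul_exp_neg_mul_atTop_nhds_zero δ (τ - σ) (by linarith)).comp
          (tendsto_atTop_add_const_left atTop 1 tendsto_id)).mul_const _).const_mul C
      refine hlim.isBoundedUnder_le.mono_le ?_
      filter_upwards [eventually_ge_atTop 0] with x hx
      refine (hbound x (by simpa using hx)).trans_eq ?_
      have h3 : ‖(1 : ℂ) + x‖ = 1 + x := by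
        rw [← ofReal_one, ← ofReal_add, norm_real, Real.norm_of_nonneg (by linarith)]
      have h4 : Real.exp (σ * x) * Real.exp (-τ * x) =
          Real.exp (-(τ - σ) * (1 + x)) * Real.exp (τ - σ) := by
        rw [← Real.exp_add, ← Real.exp_add]; congr 1; ring
      rw [h3, norm_real, Real.norm_of_nonneg hx, ofReal_re]
      linear_combination C * (1 + x) ^ δ * h4
    · intro y
      rw [hfn _ (by simp)]
      have h5 : I * (y * I) = ((-y : ℝ) : ℂ) := by
        push_cast; linear_combination (y : ℂ) * I_mul_I
      rw [h5, ofReal_neg, heven]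
      simpa using hreal y
  have h6 := key (y - x * I) (by simpa using hy)
  have h7 : I * (y - x * I) = x + y * I := by linear_combination (-x : ℂ) * I_mul_I
  rw [hfn _ (by simpa using hy), h7] at h6
  have h8 : max 1 |x| ≤ ‖1 + ((y : ℂ) - x * I)‖ := by
    refine max_le ?_ ?_
    · refine le_trans ?_ (abs_re_le_norm _)
      rw [le_abs]; left; simpa using hy
    · refine le_trans ?_ (abs_im_le_norm _)
      simp
  have h9 : ‖F (x + y * I)‖ * max 1 |x| ^ δ * Real.exp (-(τ * y)) ≤ C₁ := by
    refine le_trans ?_ h6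
    have h10 : ((y : ℂ) - x * I).re = y := by simp
    rw [h10, neg_mul]
    gcongr
  rw [Real.exp_neg, ← div_eq_mul_inv, div_le_iff₀ (Real.exp_pos _)] at h9
  rwa [abs_of_nonneg hy]

end PhragmenLindelof

/-! ### Residues of the cotangent kernel -/

section AbelPlana
open Complex

/-- The kernel `(e^{2πiz} + 1) / (e^{2πiz} - 1) = -i cot (πz)`. -/
noncomputable def cotKernel (z : ℂ) : ℂ :=
  (exp (2 * Real.pi * I * z) + 1) / (exp (2 * Real.pi * I * z) - 1)

/-- The integral over the boundary of the rectangle `[x₁, x₂] × [-R, R]`. -/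
noncomputable def rectIntegral (f : ℂ → ℂ) (x₁ x₂ R : ℝ) : ℂ :=
  (∫ x in x₁..x₂, f (x + (-R : ℝ) * I)) - (∫ x in x₁..x₂, f (x + R * I)) +
    I * (∫ y in -R..R, f (x₂ + y * I)) - I * ∫ y in -R..R, f (x₁ + y * I)

lemma exp_two_pi_add_int (z : ℂ) (n : ℤ) :
    exp (2 * Real.pi * I * (z + n)) = exp (2 * Real.pi * I * z) := by
  rw [mul_add, exp_add, show 2 * (Real.pi : ℂ) * I * n = n * (2 * Real.pi * I) by ring,
    exp_int_mul_two_pi_mul_I, mul_one]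

lemma cotKernel_add_int (z : ℂ) (n : ℤ) : cotKernel (z + n) = cotKernel z := by
  rw [cotKernel, exp_two_pi_add_int, cotKernel]

lemma cotKernel_neg (z : ℂ) : cotKernel (-z) = -cotKernel z := by
  rw [cotKernel, cotKernel, mul_neg, exp_neg]
  have h := exp_ne_zero (2 * Real.pi * I * z)
  generalize exp (2 * Real.pi * I * z) = e at h
  by_cases h1 : e = 1
  · simp [h1]
  have h2 : e - 1 ≠ 0 := sub_ne_zero.2 h1
  have h3 : e⁻¹ - 1 ≠ 0 := by
    rw [sub_ne_zero]; simpa using h1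
  rw [← neg_div, div_eq_div_iff h3 h2]
  field_simp
  ring

lemma exp_two_pi_eq_one_iff (z : ℂ) : exp (2 * Real.pi * I * z) = 1 ↔ ∃ n : ℤ, z = n := by
  rw [exp_eq_one_iff]
  refine exists_congr fun n => ?_
  rw [mul_comm]
  exact mul_left_inj' two_pi_I_ne_zero

lemma exp_sub_one_ne_zero_of_im_ne_zero {z : ℂ} (hz : z.im ≠ 0) :
    exp (2 * Real.pi * I * z) - 1 ≠ 0 := by
  rw [sub_ne_zero, Ne, exp_two_pi_eq_one_iff]
  rintro ⟨n, rfl⟩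
  simp at hz

lemma norm_exp_two_pi (z : ℂ) :
    ‖exp (2 * Real.pi * I * z)‖ = Real.exp (-(2 * Real.pi * z.im)) := by
  rw [norm_exp]; simp

lemma continuous_cotKernel_comp {p : ℝ → ℂ} (hp : Continuous p)
    (h : ∀ x, exp (2 * Real.pi * I * p x) - 1 ≠ 0) : Continuous fun x => cotKernel (p x) := by
  unfold cotKernel
  exact Continuous.div (by fun_prop) (by fun_prop) h

lemma continuous_cotKernel_horizontal {R : ℝ} (hR : R ≠ 0) :
    Continuous fun x : ℝ => cotKernel (x + R * I) :=
  continuous_cotKernel_comp (by fun_prop) fun x => exp_sub_one_ne_zero_of_im_ne_zero (by simpa)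

lemma exp_two_pi_half_add (n : ℤ) (y : ℝ) :
    exp (2 * Real.pi * I * ((n + 1 / 2 : ℝ) + y * I)) = -(Real.exp (-(2 * Real.pi * y)) : ℂ) := by
  rw [show (((n + 1 / 2 : ℝ) : ℂ) + y * I) = (1 / 2 + y * I) + n by push_cast; ring,
    exp_two_pi_add_int, mul_add, exp_add,
    show 2 * (Real.pi : ℂ) * I * (1 / 2) = Real.pi * I by ring, exp_pi_mul_I, neg_one_mul,
    ofReal_exp]
  congr 2
  push_cast
  linear_combination (2 * Real.pi * y : ℂ) * I_mul_I

lemma exp_two_pi_half_sub_one_ne_zero (n : ℤ) (y : ℝ) :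
    exp (2 * Real.pi * I * ((n + 1 / 2 : ℝ) + y * I)) - 1 ≠ 0 := by
  rw [exp_two_pi_half_add]
  have : (-(Real.exp (-(2 * Real.pi * y)) : ℂ) - 1) = ((-Real.exp (-(2 * Real.pi * y)) - 1 : ℝ) : ℂ) := by
    push_cast; ring
  rw [this, Ne, ofReal_eq_zero]
  have := Real.exp_pos (-(2 * Real.pi * y))
  linarith

lemma continuous_cotKernel_vertical (n : ℤ) :
    Continuous fun y : ℝ => cotKernel ((n + 1 / 2 : ℝ) + y * I) :=
  continuous_cotKernel_comp (by fun_prop) (exp_two_pi_half_sub_one_ne_zero n)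

lemma rectIntegral_add {f : ℂ → ℂ} {x₁ x₂ x₃ R : ℝ}
    (h₁ : Continuous fun x : ℝ => f (x + (-R : ℝ) * I))
    (h₂ : Continuous fun x : ℝ => f (x + R * I)) :
    rectIntegral f x₁ x₂ R + rectIntegral f x₂ x₃ R = rectIntegral f x₁ x₃ R := by
  simp only [rectIntegral]
  rw [← intervalIntegral.integral_add_adjacent_intervals (h₁.intervalIntegrable x₁ x₂)
      (h₁.intervalIntegrable x₂ x₃),
    ← intervalIntegral.integral_add_adjacent_intervals (h₂.intervalIntegrable x₁ x₂)
      (h₂.intervalIntegrable x₂ x₃)]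
  ring

lemma rectIntegral_shift (f : ℂ → ℂ) (x₁ x₂ R s : ℝ) :
    rectIntegral f (x₁ + s) (x₂ + s) R = rectIntegral (fun z => f (z + s)) x₁ x₂ R := by
  have h : ∀ r : ℝ, ∫ x in x₁ + s..x₂ + s, f (x + r * I) = ∫ x in x₁..x₂, f (x + r * I + s) := by
    intro r
    rw [← intervalIntegral.integral_comp_add_right (fun x : ℝ => f (x + r * I)) s]
    refine intervalIntegral.integral_congr fun x _ => ?_
    congr 1; push_cast; ring
  simp only [rectIntegral, h]
  simp only [ofReal_add, add_right_comm _ (s : ℂ)]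

lemma rectIntegral_eq_zero {f : ℂ → ℂ} {x₁ x₂ R : ℝ}
    (h : DifferentiableOn ℂ f (re ⁻¹' Set.uIcc x₁ x₂)) : rectIntegral f x₁ x₂ R = 0 := by
  have := integral_boundary_rect_eq_zero_of_differentiableOn f (x₁ + (-R : ℝ) * I) (x₂ + R * I)
    (h.mono fun z hz => by simpa using hz.1)
  simpa [rectIntegral] using this

/-- A primitive is -x + log(1 - e)/(πi) with e = e^{2πi(x+iR)}. As |e| < 1 for R > 0, the principal
logarithm is smooth there, and it cancels because e has period 1. -/
lemma integral_cotKernel_horizontal {R : ℝ} (hR : 0 < R) :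
    ∫ x in (-(1 / 2) : ℝ)..1 / 2, cotKernel (x + R * I) = -1 := by
  set e : ℝ → ℂ := fun x => exp (2 * Real.pi * I * (x + R * I))
  have he : ∀ x, ‖e x‖ < 1 := fun x => by
    rw [norm_exp_two_pi]
    have := Real.pi_pos
    simp; positivity
  have hslit : ∀ x, 1 - e x ∈ slitPlane := fun x => by
    have := mem_slitPlane_of_norm_lt_one (z := -e x) (by simpa using he x)
    rwa [← sub_eq_add_neg] at this
  have hde : ∀ x, HasDerivAt e (e x * (2 * Real.pi * I)) x := by
    intro x
    have h1 : HasDerivAt (fun z : ℂ => exp (2 * Real.pi * I * (z + R * I)))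
        (e x * (2 * Real.pi * I)) (x : ℂ) := by
      simpa using (((hasDerivAt_id (x : ℂ)).add_const (R * I)).const_mul
        (2 * Real.pi * I)).cexp
    exact h1.comp_ofReal
  set Φ : ℝ → ℂ := fun x => -x + (Real.pi * I)⁻¹ * log (1 - e x)
  have hpi : (Real.pi : ℂ) ≠ 0 := by exact_mod_cast Real.pi_ne_zero
  have hΦ : ∀ x : ℝ, HasDerivAt Φ (cotKernel (x + R * I)) x := by
    intro x
    have h2 : 1 - e x ≠ 0 := slitPlane_ne_zero (hslit x)
    have h3 : e x - 1 ≠ 0 := by rw [← neg_ne_zero]; simpa using h2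
    have h4 := (((hde x).const_sub 1).clog_real (hslit x)).const_mul ((Real.pi * I)⁻¹ : ℂ)
    have h5 := ((hasDerivAt_id (x : ℂ)).comp_ofReal).neg.add h4
    convert! h5 using 1
    change (e x + 1) / (e x - 1) = _
    field_simp
    ring
  rw [intervalIntegral.integral_eq_sub_of_hasDerivAt (fun x _ => hΦ x)
    ((continuous_cotKernel_horizontal hR.ne').intervalIntegrable _ _)]
  have hper : e (1 / 2) = e (-(1 / 2)) := by
    simp only [e]
    rw [← exp_two_pi_add_int _ 1]
    have := exp_two_pi_add_int (((-(1 / 2) : ℝ) : ℂ) + R * I) 1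
    rw [exp_two_pi_add_int, ← this]
    congr 2; push_cast; ring
  simp only [Φ, hper]
  push_cast; ring

lemma integral_odd_horizontal {f : ℂ → ℂ} (hf : ∀ z, f (-z) = -f z) (L R : ℝ) :
    ∫ x in -L..L, f (x + (-R : ℝ) * I) = -∫ x in -L..L, f (x + R * I) := by
  have h := intervalIntegral.integral_comp_neg (a := -L) (b := L)
    (fun x : ℝ => f (x + (-R : ℝ) * I))
  rw [neg_neg] at h
  rw [← h, ← intervalIntegral.integral_neg]
  refine intervalIntegral.integral_congr fun x _ => ?_
  rw [← hf]
  congr 1; push_cast; ring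

lemma rectIntegral_odd {f : ℂ → ℂ} (hf : ∀ z, f (-z) = -f z) (L R : ℝ) :
    rectIntegral f (-L) L R =
      2 * (-(∫ x in -L..L, f (x + R * I)) + I * ∫ y in -R..R, f (L + y * I)) := by
  have h : ∫ y in -R..R, f ((-L : ℝ) + y * I) = -∫ y in -R..R, f (L + y * I) := by
    have h := intervalIntegral.integral_comp_neg (a := -R) (b := R)
      (fun y : ℝ => f ((-L : ℝ) + y * I))
    rw [neg_neg] at h
    rw [← h, ← intervalIntegral.integral_neg]
    refine intervalIntegral.integral_congr fun x _ => ?_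
    rw [← hf]
    congr 1; push_cast; ring
  rw [rectIntegral, integral_odd_horizontal hf, h]
  ring

lemma rectIntegral_cotKernel {R : ℝ} (hR : 0 < R) :
    rectIntegral cotKernel (-(1 / 2)) (1 / 2) R = 2 := by
  have h : ∫ y in -R..R, cotKernel ((-(1 / 2) : ℝ) + y * I)
      = ∫ y in -R..R, cotKernel ((1 / 2 : ℝ) + y * I) := by
    refine intervalIntegral.integral_congr fun y _ => ?_
    rw [← cotKernel_add_int _ 1]
    congr 1; push_cast; ring
  rw [rectIntegral, integral_odd_horizontal cotKernel_neg, integral_cotKernel_horizontal hR, h]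
  ring

/-- The residue of `G(z) (-i cot πz)` at the origin. -/
lemma rectIntegral_mul_cotKernel_cell {G : ℂ → ℂ} (hG : Differentiable ℂ G) {R : ℝ} (hR : 0 < R) :
    rectIntegral (fun z => G z * cotKernel z) (-(1 / 2)) (1 / 2) R = 2 * G 0 := by
  set e : ℂ → ℂ := fun z => exp (2 * Real.pi * I * z)
  have he : Differentiable ℂ e := by fun_prop
  -- Dividing out the zeros at 0 stands in for the residue theorem: e - 1 = z q with q zero-free on
  -- |Re z| ≤ 1/2, and G - G(0) = z D. So G times the kernel is the holomorphic H plus G(0) times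
  -- the kernel, whose integral is known.
  set q := dslope e 0
  set D := dslope G 0
  have hdslope : ∀ f : ℂ → ℂ, Differentiable ℂ f → Differentiable ℂ (dslope f 0) := fun f hf => by
    rw [← differentiableOn_univ] at hf ⊢
    exact (differentiableOn_dslope univ_mem).2 hf
  have heq : ∀ z, e z - 1 = z * q z := fun z => by
    have := sub_smul_dslope e 0 z
    simpa [e] using this.symm
  have hGD : ∀ z, G z - G 0 = z * D z := fun z => by
    simpa using (sub_smul_dslope G 0 z).symm
  have hq : ∀ z : ℂ, |z.re| ≤ 1 / 2 → q z ≠ 0 := by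
    intro z hz hqz
    by_cases h0 : z = 0
    · have h1 : HasDerivAt e (2 * Real.pi * I) 0 := by
        simpa [e] using ((hasDerivAt_id (0 : ℂ)).const_mul (2 * Real.pi * I)).cexp
      rw [h0] at hqz
      simp only [q, dslope_same, h1.deriv] at hqz
      exact two_pi_I_ne_zero hqz
    · have h1 := heq z
      rw [hqz, mul_zero, sub_eq_zero] at h1
      obtain ⟨n, rfl⟩ := (exp_two_pi_eq_one_iff z).1 h1
      rw [intCast_re, abs_le] at hz
      have h2 : n < 1 := by exact_mod_cast (by linarith [hz.2] : (n : ℝ) < 1)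
      have h3 : -1 < n := by exact_mod_cast (by linarith [hz.1] : (-1 : ℝ) < n)
      exact h0 (by simp [show n = 0 by omega])
  set H : ℂ → ℂ := fun z => D z * (e z + 1) / q z
  have hsplit : ∀ z : ℂ, |z.re| ≤ 1 / 2 → z ≠ 0 →
      G z * cotKernel z = H z + G 0 * cotKernel z := by
    intro z hz h0
    have h1 := hq z hz
    change G z * ((e z + 1) / (e z - 1)) = D z * (e z + 1) / q z + G 0 * ((e z + 1) / (e z - 1))
    rw [heq, ← sub_eq_iff_eq_add, ← sub_mul, hGD]
    field_simp
  have hHd : DifferentiableOn ℂ H (re ⁻¹' Set.uIcc (-(1 / 2)) (1 / 2)) := by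
    intro z hz
    rw [Set.uIcc_of_le (by norm_num)] at hz
    exact (((hdslope G hG z).mul ((he z).add_const 1)).div (hdslope e he z)
      (hq z (abs_le.2 hz))).differentiableWithinAt
  have hH0 := rectIntegral_eq_zero (R := R) hHd
  have hhor : ∀ r : ℝ, r ≠ 0 → ∫ x in (-(1 / 2) : ℝ)..1 / 2, (G (x + r * I) * cotKernel (x + r * I))
      = (∫ x in (-(1 / 2) : ℝ)..1 / 2, H (x + r * I)) +
        G 0 * ∫ x in (-(1 / 2) : ℝ)..1 / 2, cotKernel (x + r * I) := by
    intro r hr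
    rw [← intervalIntegral.integral_const_mul, ← intervalIntegral.integral_add]
    · refine intervalIntegral.integral_congr fun x hx => ?_
      rw [Set.uIcc_of_le (by norm_num)] at hx
      refine hsplit _ (by simpa [abs_le] using hx) fun h => hr ?_
      simpa using congrArg im h
    · refine (hHd.continuousOn.comp (by fun_prop) fun x hx => ?_).intervalIntegrable
      simpa using hx
    · exact ((continuous_cotKernel_horizontal hr).const_mul _).intervalIntegrable _ _
  have hver : ∀ (s : ℝ) (n : ℤ), s = n + 1 / 2 → |s| = 1 / 2 →
      ∫ y in -R..R, (G (s + y * I) * cotKernel (s + y * I))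
      = (∫ y in -R..R, H (s + y * I)) + G 0 * ∫ y in -R..R, cotKernel (s + y * I) := by
    intro s n hs hs2
    rw [← intervalIntegral.integral_const_mul, ← intervalIntegral.integral_add]
    · refine intervalIntegral.integral_congr fun y _ => ?_
      refine hsplit _ (by simpa using hs2.le) fun h => ?_
      have : s = 0 := by simpa using congrArg re h
      simp [this] at hs2
    · refine (hHd.continuousOn.comp (by fun_prop) fun y _ => ?_).intervalIntegrable
      rw [Set.uIcc_of_le (by norm_num)]
      simpa [abs_le] using hs2.le
    · rw [hs]
      exact ((continuous_cotKernel_vertical n).const_mul _).intervalIntegrable _ _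
  have h1 := rectIntegral_cotKernel hR
  rw [rectIntegral] at h1 hH0 ⊢
  rw [hhor (-R) (by linarith), hhor R hR.ne', hver (1 / 2) 0 (by simp) (by norm_num [abs_of_pos]),
    hver (-(1 / 2)) (-1) (by norm_num) (by norm_num [abs_of_pos])]
  linear_combination hH0 + G 0 * h1

/-- Each unit cell contributes twice the value of F at its centre. The cells at ±m agree by evenness
and give 4 F(m), while the single cell at 0 gives 2 F(0): hence the weight 1/2. -/
lemma rectIntegral_mul_cotKernel {F : ℂ → ℂ} (hF : Differentiable ℂ F)
    (heven : ∀ z, F (-z) = F z) {R : ℝ} (hR : 0 < R) (M : ℕ) :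
    rectIntegral (fun z => F z * cotKernel z) (-(M + 1 / 2)) (M + 1 / 2) R =
      4 * ∑ m ∈ Finset.range (M + 1), epsilonWeight m * F m := by
  have hcell : ∀ s : ℤ, rectIntegral (fun z => F z * cotKernel z) (-(1 / 2) + s) (1 / 2 + s) R
      = 2 * F s := by
    intro s
    rw [rectIntegral_shift]
    have h := rectIntegral_mul_cotKernel_cell (G := fun z => F (z + s)) (by fun_prop) hR
    simp only [zero_add] at h
    rw [← h]
    congr 1
    funext z
    rw [ofReal_intCast, cotKernel_add_int]
  have hc : ∀ r : ℝ, r ≠ 0 → Continuous fun x : ℝ => F (x + r * I) * cotKernel (x + r * I) :=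
    fun r hr => (hF.continuous.comp (by fun_prop)).mul (continuous_cotKernel_horizontal hr)
  have hadd : ∀ x₁ x₂ x₃ : ℝ, rectIntegral (fun z => F z * cotKernel z) x₁ x₂ R +
      rectIntegral (fun z => F z * cotKernel z) x₂ x₃ R =
      rectIntegral (fun z => F z * cotKernel z) x₁ x₃ R :=
    fun _ _ _ => rectIntegral_add (hc (-R) (by linarith)) (hc R hR.ne')
  induction M with
  | zero =>
    have := hcell 0
    simp only [Int.cast_zero, add_zero] at this
    simp only [CharP.cast_eq_zero, zero_add, Finset.sum_range_one, epsilonWeight, if_true]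
    rw [this]; ring
  | succ M ih =>
    rw [Finset.sum_range_succ, mul_add, ← ih]
    have h1 := hcell ((M + 1 : ℕ) : ℤ)
    have h2 := hcell (-((M + 1 : ℕ) : ℤ))
    have e1 : -(1 / 2) + (((M + 1 : ℕ) : ℤ) : ℝ) = M + 1 / 2 := by push_cast; ring
    have e2 : 1 / 2 + (((M + 1 : ℕ) : ℤ) : ℝ) = (M + 1 : ℕ) + 1 / 2 := by push_cast; ring
    have e3 : -(1 / 2) + ((-((M + 1 : ℕ) : ℤ) : ℤ) : ℝ) = -((M + 1 : ℕ) + 1 / 2) := by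
      push_cast; ring
    have e4 : 1 / 2 + ((-((M + 1 : ℕ) : ℤ) : ℤ) : ℝ) = -(M + 1 / 2) := by push_cast; ring
    rw [e1, e2] at h1
    rw [e3, e4, Int.cast_neg, heven] at h2
    rw [← hadd _ (-(M + 1 / 2) : ℝ) _, ← hadd (-(M + 1 / 2) : ℝ) (M + 1 / 2) _, h1, h2]
    simp only [epsilonWeight, Nat.succ_ne_zero, if_false, Int.cast_natCast]
    ring

end AbelPlana

/-! ### The Abel–Plana formula and its error term -/

section AbelPlanaLimit
open Complex

lemma integral_neg_self_eq {g : ℝ → ℂ} (hg : Continuous g) (R : ℝ) :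
    ∫ y in -R..R, g y = ∫ y in (0 : ℝ)..R, (g y + g (-y)) := by
  have hg' : Continuous fun y => g (-y) := by fun_prop
  rw [intervalIntegral.integral_add (hg.intervalIntegrable _ _)
    (hg'.intervalIntegrable _ _), intervalIntegral.integral_comp_neg, neg_zero,
    add_comm]
  exact (intervalIntegral.integral_add_adjacent_intervals (hg.intervalIntegrable _ _)
    (hg.intervalIntegrable _ _)).symm

lemma integral_exp_neg_mul_le {c : ℝ} (hc : 0 < c) (R : ℝ) :
    ∫ y in (0 : ℝ)..R, Real.exp (-c * y) ≤ 1 / c := by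
  have h : ∀ y : ℝ, HasDerivAt (fun y => -(Real.exp (-c * y) / c)) (Real.exp (-c * y)) y := by
    intro y
    convert! ((((hasDerivAt_id y).const_mul (-c)).exp).div_const c).neg using 1
    simp only [id]
    field_simp
  rw [intervalIntegral.integral_eq_sub_of_hasDerivAt (fun y _ => h y)
    ((by fun_prop : Continuous fun y => Real.exp (-c * y)).intervalIntegrable _ _)]
  have := Real.exp_pos (-c * R)
  have : 0 < Real.exp (-c * R) / c := by positivity
  simp only [mul_zero, Real.exp_zero]
  linarith

lemma cotKernel_add_one {z : ℂ} (h : exp (2 * Real.pi * I * z) - 1 ≠ 0) :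
    cotKernel z + 1 = 2 * exp (2 * Real.pi * I * z) / (exp (2 * Real.pi * I * z) - 1) := by
  rw [cotKernel, div_add_one h]; ring

/-- On a half-integer abscissa e^{2πiz} is a negative real, so the denominator has modulus at least
1 all the way down to the real axis. -/
lemma norm_cotKernel_add_one_vertical_le (n : ℤ) (y : ℝ) :
    ‖cotKernel ((n + 1 / 2 : ℝ) + y * I) + 1‖ ≤ 2 * Real.exp (-(2 * Real.pi * y)) := by
  rw [cotKernel_add_one (exp_two_pi_half_sub_one_ne_zero n y), exp_two_pi_half_add, norm_div]
  have h0 := Real.exp_pos (-(2 * Real.pi * y))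
  set ε := Real.exp (-(2 * Real.pi * y))
  have h1 : ‖-(ε : ℂ) - 1‖ = ε + 1 := by
    rw [show -(ε : ℂ) - 1 = -((ε + 1 : ℝ) : ℂ) by push_cast; ring, norm_neg, norm_real,
      Real.norm_of_nonneg (by linarith)]
  rw [h1, norm_mul, norm_neg, norm_real, Real.norm_of_nonneg h0.le, Complex.norm_two]
  exact div_le_self (by linarith) (by linarith)

lemma norm_cotKernel_add_one_horizontal_le {R : ℝ} (hR : 1 ≤ R) (x : ℝ) :
    ‖cotKernel (x + R * I) + 1‖ ≤ 4 * Real.exp (-(2 * Real.pi * R)) := by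
  have hne : exp (2 * Real.pi * I * (x + R * I)) - 1 ≠ 0 :=
    exp_sub_one_ne_zero_of_im_ne_zero (by simp; linarith)
  rw [cotKernel_add_one hne, norm_div, norm_mul, Complex.norm_two]
  have h1 := norm_exp_two_pi (x + R * I)
  have him : ((x : ℂ) + R * I).im = R := by simp
  rw [him] at h1
  have h2 := norm_sub_norm_le 1 (exp (2 * Real.pi * I * (x + R * I)))
  rw [norm_one, norm_sub_rev, h1] at h2
  have h3 : Real.exp (-(2 * Real.pi * R)) ≤ 1 / 2 := by
    rw [Real.exp_neg, inv_eq_one_div]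
    gcongr
    have := Real.add_one_le_exp (2 * Real.pi * R)
    nlinarith [Real.pi_gt_three]
  rw [h1, div_le_iff₀ (norm_pos_iff.2 hne)]
  nlinarith [Real.exp_pos (-(2 * Real.pi * R))]

/-- The Abel–Plana formula on `[-L, L]`, `L = M + 1/2`, for an even entire function. -/
lemma sum_sub_integral_eq {F : ℂ → ℂ} (hF : Differentiable ℂ F) (heven : ∀ z, F (-z) = F z)
    {R : ℝ} (hR : 0 < R) (M : ℕ) {L : ℝ} (hL : L = M + 1 / 2) :
    2 * ((∑ m ∈ Finset.range (M + 1), epsilonWeight m * F m) - ∫ x in (0 : ℝ)..L, F x) =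
      -(∫ x in -L..L, F (x + R * I) * (cotKernel (x + R * I) + 1)) +
        I * ∫ y in (0 : ℝ)..R, (F (L + y * I) - F (L + (-y : ℝ) * I)) *
          (cotKernel (L + y * I) + 1) := by
  have hFc := hF.continuous
  have hLn : L = ((M : ℤ) : ℝ) + 1 / 2 := by simpa using hL
  have hkv : Continuous fun y : ℝ => cotKernel (L + y * I) := by
    rw [hLn]; exact continuous_cotKernel_vertical M
  have hkh := continuous_cotKernel_horizontal hR.ne'
  have h1 := rectIntegral_mul_cotKernel hF heven hR M
  rw [← hL, rectIntegral_odd (fun z => by rw [heven, cotKernel_neg, mul_neg])] at h1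
  -- Cauchy's theorem for F alone on the upper half rectangle: it trades the integral over [-L, L]
  -- for the other sides, which adds 1 to the kernel there.
  have h2 := integral_boundary_rect_eq_zero_of_differentiableOn F ((-L : ℝ) : ℂ) (L + R * I)
    hF.differentiableOn
  simp only [ofReal_re, ofReal_im, add_re, mul_re, I_re, I_im, mul_zero, mul_one,
    add_im, mul_im, zero_add, add_zero, ofReal_zero, zero_mul, smul_eq_mul, sub_self] at h2
  have h3 : ∫ y in (0 : ℝ)..R, F ((-L : ℝ) + y * I) = ∫ y in (0 : ℝ)..R, F (L + (-y : ℝ) * I) := by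
    refine intervalIntegral.integral_congr fun y _ => ?_
    rw [← heven]; congr 1; push_cast; ring
  have h4 : ∫ x in -L..L, F x = 2 * ∫ x in (0 : ℝ)..L, F x := by
    rw [integral_neg_self_eq (g := fun x : ℝ => F x) (by fun_prop),
      ← intervalIntegral.integral_const_mul]
    refine intervalIntegral.integral_congr fun y _ => ?_
    simp only [ofReal_neg, heven]; ring
  have h5 : ∫ y in -R..R, F (L + y * I) * cotKernel (L + y * I) =
      ∫ y in (0 : ℝ)..R, (F (L + y * I) - F (L + (-y : ℝ) * I)) * cotKernel (L + y * I) := by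
    rw [integral_neg_self_eq (g := fun y : ℝ => F (L + y * I) * cotKernel (L + y * I))
      (Continuous.mul (by fun_prop) hkv)]
    refine intervalIntegral.integral_congr fun y _ => ?_
    -- The points L - iy and -(L + iy) differ by 2L = 2M + 1, a period of the kernel.
    have h6 : cotKernel (L + (-y : ℝ) * I) = -cotKernel (L + y * I) := by
      rw [← cotKernel_neg, ← cotKernel_add_int _ (-((2 * M + 1 : ℕ) : ℤ))]
      rw [← cotKernel_add_int (-((L : ℂ) + y * I)) 0]
      congr 1
      rw [hL]; push_cast; ring
    simp only [h6]
    ring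
  have h7 : ∫ x in -L..L, F (x + R * I) * (cotKernel (x + R * I) + 1) =
      (∫ x in -L..L, F (x + R * I) * cotKernel (x + R * I)) + ∫ x in -L..L, F (x + R * I) := by
    rw [← intervalIntegral.integral_add]
    · simp only [mul_add, mul_one]
    · exact (Continuous.mul (by fun_prop) hkh).intervalIntegrable _ _
    · exact Continuous.intervalIntegrable (by fun_prop) _ _
  have h8 : ∫ y in (0 : ℝ)..R, (F (L + y * I) - F (L + (-y : ℝ) * I)) * (cotKernel (L + y * I) + 1)
      = (∫ y in (0 : ℝ)..R, (F (L + y * I) - F (L + (-y : ℝ) * I)) * cotKernel (L + y * I)) +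
        ((∫ y in (0 : ℝ)..R, F (L + y * I)) - ∫ y in (0 : ℝ)..R, F (L + (-y : ℝ) * I)) := by
    rw [← intervalIntegral.integral_sub, ← intervalIntegral.integral_add]
    · simp only [mul_add, mul_one]
    · exact (Continuous.mul (by fun_prop) hkv).intervalIntegrable _ _
    · exact Continuous.intervalIntegrable (by fun_prop) _ _
    · exact Continuous.intervalIntegrable (by fun_prop) _ _
    · exact Continuous.intervalIntegrable (by fun_prop) _ _
  rw [h3, h4] at h2
  rw [h5] at h1
  rw [h7, h8]
  linear_combination (-1 / 2 : ℂ) * h1 - h2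

lemma norm_sum_sub_integral_le {F : ℂ → ℂ} (hF : Differentiable ℂ F)
    (heven : ∀ z, F (-z) = F z) {C τ δ : ℝ} (hτ : τ < 2 * Real.pi) (hδ : 0 ≤ δ)
    (hb : ∀ x y : ℝ, ‖F (x + y * I)‖ * max 1 |x| ^ δ ≤ C * Real.exp (τ * |y|))
    {M : ℕ} (hM : 1 ≤ M) {L : ℝ} (hL : L = M + 1 / 2) :
    ‖2 * ((∑ m ∈ Finset.range (M + 1), epsilonWeight m * F m) - ∫ x in (0 : ℝ)..L, F x)‖ ≤
      8 * C * (L * Real.exp (-(2 * Real.pi - τ) * L)) +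
        4 * C / (2 * Real.pi - τ) * L ^ (-δ) := by
  have hM' : (1 : ℝ) ≤ M := by exact_mod_cast hM
  have hL1 : 1 ≤ L := by rw [hL]; linarith
  have hL0 : 0 < L := by linarith
  have hc : 0 < 2 * Real.pi - τ := by linarith
  have hC : 0 ≤ C := by
    have := (mul_nonneg (norm_nonneg _) (by positivity)).trans (hb 0 0)
    simpa using this
  have hb1 : ∀ x y : ℝ, ‖F (x + y * I)‖ ≤ C * Real.exp (τ * |y|) := fun x y =>
    (le_mul_of_one_le_right (norm_nonneg _)
      (Real.one_le_rpow (le_max_left _ _) hδ)).trans (hb x y)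
  have hbL : ∀ y : ℝ, ‖F (L + y * I)‖ ≤ C * L ^ (-δ) * Real.exp (τ * |y|) := fun y => by
    have h := hb L y
    rw [abs_of_pos hL0, max_eq_right hL1, ← le_div_iff₀ (by positivity)] at h
    refine h.trans_eq ?_
    rw [Real.rpow_neg hL0.le]; ring
  -- The height is taken to be R = L. The top side, of length 2L, then contributes an exponentially
  -- small term, and the right side L^{-δ} times a convergent integral.
  rw [sum_sub_integral_eq hF heven hL0 M hL]
  refine (norm_add_le _ _).trans ?_
  rw [norm_neg, norm_mul, norm_I, one_mul]
  gcongr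
  · have h1 : ∀ x ∈ Set.uIoc (-L) L, ‖F (x + L * I) * (cotKernel (x + L * I) + 1)‖ ≤
        4 * C * Real.exp (-(2 * Real.pi - τ) * L) := by
      intro x _
      rw [norm_mul]
      have h2 := hb1 x L
      have h3 := norm_cotKernel_add_one_horizontal_le hL1 x
      rw [abs_of_pos hL0] at h2
      calc _ ≤ C * Real.exp (τ * L) * (4 * Real.exp (-(2 * Real.pi * L))) := by gcongr
        _ = _ := by
          rw [show -(2 * Real.pi - τ) * L = τ * L + -(2 * Real.pi * L) by ring, Real.exp_add]; ring
    refine (intervalIntegral.norm_integral_le_of_norm_le_const h1).trans_eq ?_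
    rw [abs_of_pos (by linarith)]; ring
  · have hLn : L = ((M : ℤ) : ℝ) + 1 / 2 := by simpa using hL
    have h1 : ∀ y : ℝ, 0 ≤ y → ‖(F (L + y * I) - F (L + (-y : ℝ) * I)) *
        (cotKernel (L + y * I) + 1)‖ ≤
        4 * C * L ^ (-δ) * Real.exp (-(2 * Real.pi - τ) * y) := by
      intro y hy
      rw [norm_mul]
      have h2 := hbL y
      have h3 := hbL (-y)
      rw [abs_neg] at h3
      rw [abs_of_nonneg hy] at h2 h3
      have h4 := norm_cotKernel_add_one_vertical_le M y
      rw [← hLn] at h4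
      have h5 := (norm_sub_le (F (L + y * I)) (F (L + (-y : ℝ) * I))).trans (add_le_add h2 h3)
      calc _ ≤ (C * L ^ (-δ) * Real.exp (τ * y) + C * L ^ (-δ) * Real.exp (τ * y)) *
            (2 * Real.exp (-(2 * Real.pi * y))) := by gcongr
        _ = _ := by
          rw [show -(2 * Real.pi - τ) * y = τ * y + -(2 * Real.pi * y) by ring, Real.exp_add]; ring
    have hcont : Continuous fun y : ℝ => 4 * C * L ^ (-δ) * Real.exp (-(2 * Real.pi - τ) * y) := by
      fun_prop
    refine (intervalIntegral.norm_integral_le_of_norm_le hL0.le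
      (Eventually.of_forall fun y hy => h1 y hy.1.le) (hcont.intervalIntegrable 0 L)).trans ?_
    rw [intervalIntegral.integral_const_mul]
    calc _ ≤ 4 * C * L ^ (-δ) * (1 / (2 * Real.pi - τ)) := by
          gcongr
          exact integral_exp_neg_mul_le hc L
      _ = _ := by ring

lemma tendsto_sum_sub_integral {F : ℂ → ℂ} (hF : Differentiable ℂ F)
    (heven : ∀ z, F (-z) = F z) {C τ δ : ℝ} (hτ : τ < 2 * Real.pi) (hδ : 0 < δ)
    (hb : ∀ x y : ℝ, ‖F (x + y * I)‖ * max 1 |x| ^ δ ≤ C * Real.exp (τ * |y|)) :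
    Tendsto (fun M : ℕ => (∑ m ∈ Finset.range (M + 1), epsilonWeight m * F m)
      - ∫ x in (0 : ℝ)..(M + 1 / 2), F x) atTop (𝓝 0) := by
  have hlim : Tendsto (fun M : ℕ => (M : ℝ) + 1 / 2) atTop atTop :=
    tendsto_atTop_add_const_right _ _ tendsto_natCast_atTop_atTop
  have h1 : Tendsto (fun L : ℝ => 8 * C * (L * Real.exp (-(2 * Real.pi - τ) * L)) +
      4 * C / (2 * Real.pi - τ) * L ^ (-δ)) atTop (𝓝 (8 * C * 0 + 4 * C / (2 * Real.pi - τ) * 0)) := by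
    refine Tendsto.add (Tendsto.const_mul _ ?_) ((tendsto_rpow_neg_atTop hδ).const_mul _)
    simpa using tendsto_rpow_mul_exp_neg_mul_atTop_nhds_zero 1 (2 * Real.pi - τ) (by linarith)
  rw [mul_zero, mul_zero, add_zero] at h1
  have h2 : Tendsto (fun M : ℕ => 2 * ((∑ m ∈ Finset.range (M + 1), epsilonWeight m * F m)
      - ∫ x in (0 : ℝ)..(M + 1 / 2), F x)) atTop (𝓝 0) := by
    refine squeeze_zero_norm' ?_ (h1.comp hlim)
    filter_upwards [eventually_ge_atTop 1] with M hM
    exact norm_sum_sub_integral_le hF heven hτ hδ.le hb hM rfl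
  have h3 := h2.const_mul (1 / 2 : ℂ)
  rw [mul_zero] at h3
  refine h3.congr fun M => ?_
  rw [← mul_assoc, one_div, inv_mul_cancel₀ two_ne_zero, one_mul]

end AbelPlanaLimit

/-! ### From the integral to the series, including type 2π -/

section Summation
open Complex Asymptotics

lemma one_le_norm_one_add_mul_I (x : ℝ) : 1 ≤ ‖1 + x * I‖ := by
  refine le_trans ?_ (abs_re_le_norm _)
  simp

lemma abs_le_norm_one_add_mul_I (x : ℝ) : |x| ≤ ‖1 + x * I‖ := by
  refine le_trans ?_ (abs_im_le_norm _)
  simp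

lemma exists_norm_mul_rpow_le {F : ℂ → ℂ} (hF : Continuous F) (heven : ∀ z, F (-z) = F z) {δ : ℝ}
    (hδ : 0 ≤ δ) (hO : (fun t : ℝ => F t) =O[atTop] fun t : ℝ => t ^ (-δ)) :
    ∃ C : ℝ, ∀ x : ℝ, ‖F x‖ * ‖1 + x * I‖ ^ δ ≤ C := by
  obtain ⟨c, hc⟩ := hO.bound
  obtain ⟨X, hX⟩ := eventually_atTop.1 (hc.and (eventually_ge_atTop 1))
  have hcont : Continuous fun x : ℝ => ‖F x‖ * ‖1 + x * I‖ ^ δ :=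
    Continuous.mul (by fun_prop) (Continuous.rpow_const (by fun_prop) fun _ => Or.inr hδ)
  obtain ⟨C, hC⟩ := (isCompact_Icc (a := (0 : ℝ)) (b := X)).bddAbove_image hcont.continuousOn
  have hpos : ∀ x : ℝ, 0 ≤ x → ‖F x‖ * ‖1 + x * I‖ ^ δ ≤ max C (c * 2 ^ δ) := by
    intro x hx
    rcases le_total x X with h | h
    · exact (hC ⟨x, ⟨hx, h⟩, rfl⟩).trans (le_max_left _ _)
    · obtain ⟨h1, h2⟩ := hX x h
      have hx0 : 0 < x := by linarith
      rw [Real.norm_of_nonneg (by positivity)] at h1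
      have h3 : ‖1 + x * I‖ ≤ 2 * x := by
        refine (norm_add_le _ _).trans ?_
        rw [norm_one, norm_mul, norm_I, norm_real, Real.norm_of_nonneg hx]
        linarith
      refine le_trans ?_ (le_max_right _ _)
      calc ‖F x‖ * ‖1 + x * I‖ ^ δ ≤ (c * x ^ (-δ)) * (2 * x) ^ δ := by
            gcongr
            exact (norm_nonneg _).trans h1
        _ = c * 2 ^ δ * (x ^ (-δ) * x ^ δ) := by rw [Real.mul_rpow two_pos.le hx]; ring
        _ = c * 2 ^ δ := by rw [← Real.rpow_add hx0]; simp
  refine ⟨max C (c * 2 ^ δ), fun x => ?_⟩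
  rcases le_total 0 x with h | h
  · exact hpos x h
  · have h1 := hpos (-x) (by linarith)
    have h2 : ‖1 + ((-x : ℝ) : ℂ) * I‖ = ‖1 + (x : ℂ) * I‖ := by
      rw [← norm_conj]; simp
    rwa [h2, ofReal_neg, heven] at h1

/-- The sum and the integral of an even entire function of exponential type less than `2π`, decaying
on the real line, converge or diverge together, and to the same limit. -/
lemma tendsto_sum_sub_integral_of_isBigO {F : ℂ → ℂ} (hF : Differentiable ℂ F)
    (heven : ∀ z, F (-z) = F z) {C σ δ : ℝ} (hσ : 0 ≤ σ) (hσ2 : σ < 2 * Real.pi) (hδ : 0 < δ)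
    (hC : 0 ≤ C) (hgrowth : ∀ z, ‖F z‖ ≤ C * Real.exp (σ * ‖z‖))
    (hO : (fun t : ℝ => F t) =O[atTop] fun t : ℝ => t ^ (-δ)) :
    Tendsto (fun M : ℕ => (∑ m ∈ Finset.range (M + 1), epsilonWeight m * F m)
      - ∫ x in (0 : ℝ)..(M + 1 / 2), F x) atTop (𝓝 0) := by
  obtain ⟨C₁, hC₁⟩ := exists_norm_mul_rpow_le hF.continuous heven hδ.le hO
  obtain ⟨τ, h1, h2⟩ := exists_between hσ2
  exact tendsto_sum_sub_integral hF heven h2 hδ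
    (norm_mul_max_rpow_le_of_even hF heven hσ h1 hδ.le hC hgrowth hC₁)

lemma tendsto_sum_of_tendsto_integral {F : ℂ → ℂ} {J : ℂ}
    (h : Tendsto (fun M : ℕ => (∑ m ∈ Finset.range (M + 1), epsilonWeight m * F m)
      - ∫ x in (0 : ℝ)..(M + 1 / 2), F x) atTop (𝓝 0))
    (hJ : Tendsto (fun T : ℝ => ∫ t in (0 : ℝ)..T, F t) atTop (𝓝 J)) :
    Tendsto (fun M : ℕ => ∑ m ∈ Finset.range M, epsilonWeight m * F m) atTop (𝓝 J) := by
  have hlim : Tendsto (fun M : ℕ => (M : ℝ) + 1 / 2) atTop atTop :=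
    tendsto_atTop_add_const_right _ _ tendsto_natCast_atTop_atTop
  rw [← tendsto_add_atTop_iff_nat 1]
  simpa using h.add (hJ.comp hlim)

lemma norm_epsilonWeight_le (m : ℕ) : ‖epsilonWeight m‖ ≤ 1 := by
  rw [epsilonWeight]
  split_ifs
  · norm_num
  · simp

/-- Exponential type at most `2π` suffices for functions decaying at an integrable rate. -/
lemma tendsto_sum_integral_of_type_le {F : ℂ → ℂ} (hF : Differentiable ℂ F)
    (heven : ∀ z, F (-z) = F z) {δ : ℝ} (hδ : 1 < δ)
    (hgrowth : ∀ σ, 2 * Real.pi < σ → ∃ C : ℝ, 0 ≤ C ∧ ∀ z, ‖F z‖ ≤ C * Real.exp (σ * ‖z‖))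
    (hO : (fun t : ℝ => F t) =O[atTop] fun t : ℝ => t ^ (-δ)) :
    ∃ J : ℂ, Tendsto (fun T : ℝ => ∫ t in (0 : ℝ)..T, F t) atTop (𝓝 J) ∧
      Tendsto (fun M : ℕ => ∑ m ∈ Finset.range M, epsilonWeight m * F m) atTop (𝓝 J) := by
  have hδ0 : 0 < δ := by linarith
  have hFc : Continuous fun t : ℝ => F t := by have := hF.continuous; fun_prop
  have hint : IntegrableOn (fun t : ℝ => F t) (Set.Ioi 0) :=
    ((hFc.locallyIntegrable.locallyIntegrableOn (Set.Ici 0)).integrableOn_of_isBigO_atTop hO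
      (integrableAtFilter_rpow_atTop_iff.2 (by linarith))).mono_set Set.Ioi_subset_Ici_self
  obtain ⟨J, hJ⟩ : ∃ J, Tendsto (fun T : ℝ => ∫ t in (0 : ℝ)..T, F t) atTop (𝓝 J) :=
    ⟨_, intervalIntegral_tendsto_integral_Ioi 0 hint tendsto_id⟩
  obtain ⟨C, hC⟩ := exists_norm_mul_rpow_le hF.continuous heven hδ0.le hO
  -- A majorant uniform in r ≥ 1/2: |1 + i r m| is at least 1 and at least m/2, hence at least
  -- (m+1)/4. It is summable because δ > 1.
  set b : ℕ → ℝ := fun m => C * 4 ^ δ * ((m : ℝ) + 1) ^ (-δ)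
  have hb : Summable b := by
    refine Summable.mul_left _ ?_
    have := (summable_nat_add_iff 1).2 (Real.summable_nat_rpow.2 (by linarith : -δ < -1))
    simpa using this
  have hle : ∀ r : ℝ, 1 / 2 ≤ r → ∀ m : ℕ, ‖epsilonWeight m * F ((r * m : ℝ) : ℂ)‖ ≤ b m := by
    intro r hr m
    have h0 : ((m : ℝ) + 1) / 4 ≤ ‖1 + ((r * m : ℝ) : ℂ) * I‖ := by
      have h1 := one_le_norm_one_add_mul_I (r * m)
      have h2 := abs_le_norm_one_add_mul_I (r * m)
      have hm : (0 : ℝ) ≤ m := m.cast_nonneg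
      rw [abs_of_nonneg (by positivity)] at h2
      nlinarith
    rw [norm_mul]
    have h3 : ‖F ((r * m : ℝ) : ℂ)‖ * (((m : ℝ) + 1) / 4) ^ δ ≤ C :=
      le_trans (by gcongr) (hC (r * m))
    rw [← le_div_iff₀ (by positivity), Real.div_rpow (by positivity) (by norm_num)] at h3
    calc _ ≤ 1 * (C / (((m : ℝ) + 1) ^ δ / 4 ^ δ)) := by
          gcongr
          exact norm_epsilonWeight_le m
      _ = b m := by
          simp only [b]
          rw [Real.rpow_neg (by positivity)]
          field_simp
  have hsum : ∀ r : ℝ, 1 / 2 ≤ r → Summable fun m : ℕ => epsilonWeight m * F ((r * m : ℝ) : ℂ) :=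
    fun r hr => Summable.of_norm_bounded hb (hle r hr)
  -- For r < 1 the growth rate σr of F(rz) can be kept below 2π by choosing 2π < σ < 2π/r. The case
  -- r = 1 follows by dominated convergence.
  have hscaled : ∀ r : ℝ, 1 / 2 ≤ r → r < 1 →
      ∑' m : ℕ, epsilonWeight m * F ((r * m : ℝ) : ℂ) = (r⁻¹ : ℝ) • J := by
    intro r hr hr1
    have hr0 : 0 < r := by linarith
    have hpi := Real.pi_pos
    obtain ⟨σ, h1, h2⟩ := exists_between
      (show 2 * Real.pi < 2 * Real.pi / r by rw [lt_div_iff₀ hr0]; nlinarith)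
    rw [lt_div_iff₀ hr0] at h2
    obtain ⟨B, hB, hBF⟩ := hgrowth σ h1
    have hrlim : Tendsto (fun t : ℝ => r * t) atTop atTop := tendsto_id.const_mul_atTop hr0
    have h3 := tendsto_sum_sub_integral_of_isBigO (F := fun z => F (r * z)) (σ := σ * r) (C := B)
      (by fun_prop) (fun z => by rw [mul_neg, heven]) (by nlinarith) h2 hδ0 hB
      (fun z => (hBF _).trans_eq (by
        rw [norm_mul, norm_real, Real.norm_of_nonneg hr0.le, mul_assoc]))
      (by
        have h4 := hO.comp_tendsto hrlim
        simp only [Function.comp_def, ofReal_mul] at h4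
        refine h4.trans (IsBigO.of_bound (r ^ (-δ)) ?_)
        filter_upwards [eventually_ge_atTop 0] with t ht
        rw [Real.mul_rpow hr0.le ht, norm_mul, Real.norm_of_nonneg (by positivity)])
    have h5 : Tendsto (fun T : ℝ => ∫ t in (0 : ℝ)..T, F (r * t)) atTop (𝓝 ((r⁻¹ : ℝ) • J)) := by
      have h6 := (hJ.comp hrlim).const_smul (r⁻¹ : ℝ)
      refine h6.congr fun T => ?_
      have := intervalIntegral.integral_comp_mul_left (a := 0) (b := T) (fun t : ℝ => F t) hr0.ne'
      simp only [mul_zero, ofReal_mul] at this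
      exact this.symm
    have h7 := tendsto_sum_of_tendsto_integral (F := fun z => F (r * z)) h3 h5
    refine tendsto_nhds_unique (hsum r hr).hasSum.tendsto_sum_nat ?_
    simpa using h7
  have hdom : Tendsto (fun r : ℝ => ∑' m : ℕ, epsilonWeight m * F ((r * m : ℝ) : ℂ)) (𝓝[<] 1)
      (𝓝 (∑' m : ℕ, epsilonWeight m * F ((1 * m : ℝ) : ℂ))) := by
    refine tendsto_tsum_of_dominated_convergence hb (fun m => ?_) ?_
    · refine Tendsto.mono_left (Continuous.tendsto ?_ _) nhdsWithin_le_nhds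
      have := hF.continuous
      fun_prop
    · filter_upwards [mem_nhdsWithin_of_mem_nhds (Ioi_mem_nhds (by norm_num : (1 / 2 : ℝ) < 1))]
        with r hr m
      exact hle r hr.le m
  have hdom2 : Tendsto (fun r : ℝ => ∑' m : ℕ, epsilonWeight m * F ((r * m : ℝ) : ℂ)) (𝓝[<] 1)
      (𝓝 J) := by
    have h8 : Tendsto (fun r : ℝ => (r⁻¹ : ℝ) • J) (𝓝[<] 1) (𝓝 ((1⁻¹ : ℝ) • J)) :=
      ((tendsto_inv₀ one_ne_zero).mono_left nhdsWithin_le_nhds).smul_const J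
    rw [inv_one, one_smul] at h8
    refine h8.congr' ?_
    filter_upwards [mem_nhdsWithin_of_mem_nhds (Ioi_mem_nhds (by norm_num : (1 / 2 : ℝ) < 1)),
      self_mem_nhdsWithin] with r hr hr1
    exact (hscaled r hr.le hr1).symm
  refine ⟨J, hJ, ?_⟩
  have h9 := (hsum 1 (by norm_num)).hasSum.tendsto_sum_nat
  rw [tendsto_nhds_unique hdom hdom2] at h9
  simpa using h9

end Summation

/-! ### Application to products of Bessel functions -/

section BesselProduct
open Complex Asymptotics

lemma differentiable_besselEntireProduct {N : ℕ} (K : ℕ) (ν : Fin N → ℂ) (a : Fin N → ℝ) :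
    Differentiable ℂ (besselEntireProduct K ν a) := by
  have h := fun j => differentiable_besselEntire (ν j)
  unfold besselEntireProduct
  fun_prop

lemma besselEntireProduct_neg {N : ℕ} (K : ℕ) (ν : Fin N → ℂ) (a : Fin N → ℝ) (z : ℂ) :
    besselEntireProduct K ν a (-z) = besselEntireProduct K ν a z := by
  simp only [besselEntireProduct, mul_neg, besselEntire_neg, (even_two_mul K).neg_pow]

/-- The excess σ - A is halved: η = (σ - A)/2 absorbs the power z^{2K}, and ρA = (σ + A)/2, with ρ >
1, bounds the Bessel factors. -/
lemma exists_norm_besselEntireProduct_le {N : ℕ} (K : ℕ) (ν : Fin N → ℂ) (a : Fin N → ℝ)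
    (ha : 0 < ∑ j, |a j|) {σ : ℝ} (hσ : ∑ j, |a j| < σ) :
    ∃ C : ℝ, 0 ≤ C ∧ ∀ z, ‖besselEntireProduct K ν a z‖ ≤ C * Real.exp (σ * ‖z‖) := by
  set A := ∑ j, |a j|
  set ρ := (1 + σ / A) / 2
  have hρ : 1 < ρ := by
    have : 1 < σ / A := (one_lt_div ha).2 hσ
    simp only [ρ]; linarith
  set η := (σ - A) / 2
  have hη : 0 < η := by simp only [η]; linarith
  have hσe : σ = η + ρ * A := by
    simp only [η, ρ]; field_simp; ring
  choose B hB hBg using fun j => exists_norm_besselEntire_le (ν j) hρ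
  refine ⟨(2 * K).factorial / η ^ (2 * K) * ∏ j, B j,
    mul_nonneg (by positivity) (Finset.prod_nonneg fun j _ => hB j), fun z => ?_⟩
  rw [besselEntireProduct, norm_mul, norm_pow, norm_prod]
  have h1 : ‖z‖ ^ (2 * K) ≤ (2 * K).factorial / η ^ (2 * K) * Real.exp (η * ‖z‖) := by
    have := Real.pow_div_factorial_le_exp (η * ‖z‖) (by positivity) (2 * K)
    rw [div_le_iff₀ (by positivity), mul_pow] at this
    rw [div_mul_eq_mul_div, le_div_iff₀ (by positivity)]
    linarith
  have h2 : ∏ j, ‖besselEntire (ν j) (a j * z)‖ ≤ (∏ j, B j) * Real.exp (ρ * A * ‖z‖) := by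
    have h3 : Real.exp (ρ * A * ‖z‖) = ∏ j, Real.exp (ρ * ‖(a j : ℂ) * z‖) := by
      rw [← Real.exp_sum]
      simp only [norm_mul, norm_real, Real.norm_eq_abs]
      rw [Finset.mul_sum, Finset.sum_mul]
      simp only [mul_assoc]
    rw [h3, ← Finset.prod_mul_distrib]
    exact Finset.prod_le_prod (fun _ _ => norm_nonneg _) fun j _ => hBg j _
  calc _ ≤ (2 * K).factorial / η ^ (2 * K) * Real.exp (η * ‖z‖) *
        ((∏ j, B j) * Real.exp (ρ * A * ‖z‖)) := by
        gcongr
    _ = _ := by rw [hσe, add_mul, Real.exp_add]; ring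

/-- The sum-integral identity for the entire function `z^{2K} ∏ⱼ gⱼ(aⱼ z)`. -/
lemma exists_tendsto_besselEntireProduct {N : ℕ} (hN : 0 < N) (K : ℕ) (ν : Fin N → ℂ)
    (a : Fin N → ℝ) (ha : ∀ j, a j ≠ 0) (hsum : ∑ j, |a j| ≤ 2 * Real.pi)
    (hν : 2 * (K : ℝ) - (N : ℝ) / 2 < ∑ j, (ν j).re)
    (hν' : (∑ j, |a j| = 2 * Real.pi ∨
        ∃ s : Fin N → ℝ, (∀ j, s j = 1 ∨ s j = -1) ∧ ∑ j, s j * a j = 0) →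
      2 * (K : ℝ) - (N : ℝ) / 2 + 1 < ∑ j, (ν j).re) :
    ∃ J : ℂ, Tendsto (fun T : ℝ => ∫ t in (0 : ℝ)..T, besselEntireProduct K ν a t) atTop (𝓝 J) ∧
      Tendsto (fun M : ℕ => ∑ m ∈ Finset.range M, epsilonWeight m * besselEntireProduct K ν a m)
        atTop (𝓝 J) := by
  set F := besselEntireProduct K ν a
  have hF : Differentiable ℂ F := differentiable_besselEntireProduct K ν a
  have heven : ∀ z, F (-z) = F z := besselEntireProduct_neg K ν a
  have hA : 0 < ∑ j, |a j| :=
    Finset.sum_pos (fun j _ => abs_pos.2 (ha j)) ⟨⟨0, hN⟩, Finset.mem_univ _⟩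
  have hgrowth := fun σ (h : ∑ j, |a j| < σ) => exists_norm_besselEntireProduct_le K ν a hA h
  set μ : ℂ := ∑ j, (ν j + 1 / 2) - (2 * K : ℕ)
  have hμ : μ.re = ∑ j, (ν j).re + (N : ℝ) / 2 - 2 * K := by
    simp only [μ, sub_re, re_sum, add_re, natCast_re, Finset.sum_add_distrib, Finset.sum_const,
      Finset.card_univ, Fintype.card_fin, nsmul_eq_mul]
    norm_num
    ring
  obtain ⟨D, hD⟩ := isBigO_besselEntireProduct K ν a ha
  have hO : (fun t : ℝ => F t) =O[atTop] fun t : ℝ => t ^ (-μ.re) := by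
    have h1 : (fun t : ℝ => ∑ p ∈ Fintype.piFinset fun _ : Fin N => ({1, -1} : Finset ℝ),
        D p * exp (I * (∑ j, p j * a j : ℝ) * t)) =O[atTop] fun _ => (1 : ℝ) := by
      refine IsBigO.fun_sum fun p _ => ?_
      refine IsBigO.of_bound ‖D p‖ (Eventually.of_forall fun t => ?_)
      rw [norm_mul, norm_exp_I_mul_ofReal_mul]; simp
    have h2 := (hD.trans (tendsto_inv_atTop_zero.isBigO_one ℝ)).add h1
    simp only [sub_add_cancel] at h2
    exact (isBigO_of_isBigO_cpow_mul h2).congr_right fun t => mul_one _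
  -- If Re μ ≤ 1, the strict inequality of `hν'` fails, which rules out both total type 2π and a
  -- vanishing signed sum.
  by_cases hcase : 1 < μ.re
  · exact tendsto_sum_integral_of_type_le hF heven hcase
      (fun σ hσ => hgrowth σ (hsum.trans_lt hσ)) hO
  · have hno : ¬ (∑ j, |a j| = 2 * Real.pi ∨
        ∃ s : Fin N → ℝ, (∀ j, s j = 1 ∨ s j = -1) ∧ ∑ j, s j * a j = 0) := fun h =>
      hcase (by rw [hμ]; linarith [hν' h])
    rw [not_or] at hno
    have hμ0 : 0 < μ.re := by rw [hμ]; linarith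
    have hFc : Continuous fun t : ℝ => F t := by have := hF.continuous; fun_prop
    obtain ⟨J, hJ⟩ := exists_tendsto_integral_of_oscillating hFc.continuousOn hμ0 _ D
      (fun p => ∑ j, p j * a j) (fun p hp h0 => hno.2 ⟨p, fun j => by
        simpa using Fintype.mem_piFinset.1 hp j, h0⟩) hD
    have hJ' : Tendsto (fun T : ℝ => ∫ t in (0 : ℝ)..T, F t) atTop
        (𝓝 ((∫ t in (0 : ℝ)..1, F t) + J)) := by
      refine (hJ.const_add _).congr fun T => ?_
      exact intervalIntegral.integral_add_adjacent_intervals (hFc.intervalIntegrable _ _)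
        (hFc.intervalIntegrable _ _)
    obtain ⟨σ, h1, h2⟩ := exists_between (lt_of_le_of_ne hsum hno.1)
    obtain ⟨C, hC, hCF⟩ := hgrowth σ h1
    exact ⟨_, hJ', tendsto_sum_of_tendsto_integral
      (tendsto_sum_sub_integral_of_isBigO hF heven (hA.trans h1).le h2 hμ0 hC hCF hO) hJ'⟩

/-- A positive factor t does not change the argument, so the principal power splits even when a is
negative. -/
lemma cpow_neg_mul_besselJ (ν : ℂ) {a t : ℝ} (ha : a ≠ 0) (ht : 0 < t) :
    (t : ℂ) ^ (-ν) * besselJ ν (a * t) = ((a : ℂ) / 2) ^ ν * besselEntire ν (a * t) := by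
  have ht' : (t : ℂ) ≠ 0 := by exact_mod_cast ht.ne'
  have ha' : (a : ℂ) / 2 ≠ 0 := by simpa using ha
  have h : ((a : ℂ) * t / 2) ^ ν = (t : ℂ) ^ ν * ((a : ℂ) / 2) ^ ν := by
    rw [show (a : ℂ) * t / 2 = t * (a / 2) by ring,
      cpow_def_of_ne_zero (mul_ne_zero ht' ha'), cpow_def_of_ne_zero ht', cpow_def_of_ne_zero ha',
      log_ofReal_mul ht ha', ← ofReal_log ht.le, ← exp_add, add_mul]
  rw [besselJ_eq, h, cpow_neg]
  have h0 : (t : ℂ) ^ ν ≠ 0 := by simp [cpow_eq_zero_iff, ht']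
  rw [← mul_assoc, ← mul_assoc, inv_mul_cancel₀ h0, one_mul]

/-- On `t > 0` the product is a constant multiple of an entire one, in which negative integer orders
are replaced by their opposites. -/
lemma exists_besselProduct_eq {N : ℕ} (k : ℤ) (ν : Fin N → ℂ) (a : Fin N → ℝ)
    (ha : ∀ j, a j ≠ 0) (J : Finset (Fin N))
    (hJ : ∀ j, j ∈ J ↔ ∃ n : ℕ, 0 < n ∧ ν j = -(n : ℂ))
    (hk : -∑ j ∈ J, ‖ν j‖ ≤ (k : ℝ)) :
    ∃ (K : ℕ) (ν' : Fin N → ℂ) (c : ℂ),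
      ∑ j, (ν' j).re - 2 * (K : ℝ) = ∑ j, (ν j).re - 2 * (k : ℝ) ∧
      ∀ t : ℝ, 0 < t → besselProduct k ν a t = c * besselEntireProduct K ν' a t := by
  -- Reflecting -n to n raises Re ν by 2n and adds 2n to the exponent of t. With K = k + ∑ n_j the
  -- quantity ∑ Re ν_j - 2k is thus unchanged, so the growth hypotheses carry over.
  have hex : ∀ j, ∃ (n : ℕ) (ν' c : ℂ), (j ∉ J → n = 0) ∧ (j ∈ J → ‖ν j‖ = n) ∧
      ν'.re = (ν j).re + 2 * n ∧ ∀ t : ℝ, 0 < t →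
        (t : ℂ) ^ (-ν j) * besselJ (ν j) (a j * t) =
          c * ((t : ℂ) ^ (2 * n) * besselEntire ν' (a j * t)) := by
    intro j
    by_cases hj : j ∈ J
    · obtain ⟨n, -, hn⟩ := (hJ j).1 hj
      refine ⟨n, n, ((a j : ℂ) / 2) ^ (ν j) * (-((a j : ℂ) ^ 2 / 4)) ^ n, fun h => absurd hj h,
        fun _ => by rw [hn, norm_neg, norm_natCast], by rw [hn]; simp; ring, fun t ht => ?_⟩
      rw [cpow_neg_mul_besselJ _ (ha j) ht, hn, besselEntire_neg_natCast,
        show -(((a j : ℂ) * t) ^ 2 / 4) = -((a j : ℂ) ^ 2 / 4) * (t : ℂ) ^ 2 by ring, mul_pow,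
        ← pow_mul]
      ring
    · exact ⟨0, ν j, ((a j : ℂ) / 2) ^ (ν j), fun _ => rfl, fun h => absurd h hj, by simp,
        fun t ht => by rw [cpow_neg_mul_besselJ _ (ha j) ht]; simp⟩
  choose n ν' c hn0 hn hre hc using hex
  have hsumn : ∑ j ∈ J, ‖ν j‖ = ((∑ j, n j : ℕ) : ℝ) := by
    rw [← Finset.sum_subset (Finset.subset_univ J) fun j _ hj => hn0 j hj, Nat.cast_sum]
    exact Finset.sum_congr rfl fun j hj => hn j hj
  have hk0 : 0 ≤ k + ((∑ j, n j : ℕ) : ℤ) := by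
    rw [hsumn] at hk
    have : (0 : ℝ) ≤ ((k + ((∑ j, n j : ℕ) : ℤ) : ℤ) : ℝ) := by
      rw [Int.cast_add, Int.cast_natCast]; linarith
    exact_mod_cast this
  obtain ⟨K, hK⟩ := Int.eq_ofNat_of_zero_le hk0
  refine ⟨K, ν', ∏ j, c j, ?_, fun t ht => ?_⟩
  · have hK' : (k : ℝ) + ((∑ j, n j : ℕ) : ℝ) = K := by exact_mod_cast hK
    simp only [hre, Finset.sum_add_distrib]
    rw [← Finset.mul_sum, ← Nat.cast_sum, ← hK']
    ring
  · have ht' : (t : ℂ) ≠ 0 := by exact_mod_cast ht.ne'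
    have h1 : (t : ℂ) ^ (2 * k) * ∏ j, (t : ℂ) ^ (2 * n j) = (t : ℂ) ^ (2 * K) := by
      rw [Finset.prod_pow_eq_pow_sum, ← zpow_natCast, ← zpow_natCast, ← zpow_add₀ ht',
        ← Finset.mul_sum]
      congr 1
      push_cast at hK ⊢
      linarith
    rw [besselProduct, besselEntireProduct, ← h1]
    simp only [hc _ t ht, Finset.prod_mul_distrib]
    ring

end BesselProduct

theorem mainTheorem1 (N : ℕ) (hN : 0 < N) (k : ℤ) (ν : Fin N → ℂ) (a : Fin N → ℝ)
    (ha : ∀ j, a j ≠ 0)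
    -- `J` is the (possibly empty) set of the indices of negative integer orders
    (J : Finset (Fin N)) (hJ : ∀ j, j ∈ J ↔ ∃ n : ℕ, 0 < n ∧ ν j = -(n : ℂ))
    -- for empty `J` this reads `0 ≤ k`
    (hk : -∑ j ∈ J, ‖ν j‖ ≤ (k : ℝ))
    (hsum : ∑ j, |a j| ≤ 2 * Real.pi)
    (hν : 2 * (k : ℝ) - (N : ℝ) / 2 < ∑ j, (ν j).re)
    (hν' : (∑ j, |a j| = 2 * Real.pi ∨
        ∃ s : Fin N → ℝ, (∀ j, s j = 1 ∨ s j = -1) ∧ ∑ j, s j * a j = 0) →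
      2 * (k : ℝ) - (N : ℝ) / 2 + 1 < ∑ j, (ν j).re) :
    ∃ f₀ I : ℂ,
      Tendsto (besselProduct k ν a) (𝓝[>] 0) (𝓝 f₀) ∧
      HasImproperIntegral (besselProduct k ν a) I ∧
      HasSeriesSum (fun m => epsilonWeight m * besselProductAt k ν a f₀ m) I := by
  obtain ⟨K, ν', c, hre, hc⟩ := exists_besselProduct_eq k ν a ha J hJ hk
  obtain ⟨I, hI, hS⟩ := exists_tendsto_besselEntireProduct hN K ν' a ha hsum (by linarith)
    (fun h => by linarith [hν' h])
  have hF : Continuous fun t : ℝ => c * besselEntireProduct K ν' a t := by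
    have := (differentiable_besselEntireProduct K ν' a).continuous
    fun_prop
  refine ⟨c * besselEntireProduct K ν' a 0, c * I, ?_, ⟨fun T hT => ?_, ?_⟩, ?_⟩
  · have h := (hF.tendsto 0).mono_left (nhdsWithin_le_nhds (s := Set.Ioi 0))
    rw [Complex.ofReal_zero] at h
    refine h.congr' ?_
    filter_upwards [self_mem_nhdsWithin] with t ht
    exact (hc t ht).symm
  · refine (hF.intervalIntegrable 0 T).congr fun t ht => ?_
    rw [Set.uIoc_of_le hT.le] at ht
    exact (hc t ht.1).symm
  · refine (hI.const_mul c).congr' ?_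
    filter_upwards [eventually_gt_atTop 0] with T hT
    rw [← intervalIntegral.integral_const_mul]
    refine intervalIntegral.integral_congr_ae (Eventually.of_forall fun t ht => ?_)
    rw [Set.uIoc_of_le hT.le] at ht
    exact (hc t ht.1).symm
  · refine (hS.const_mul c).congr fun M => ?_
    rw [Finset.mul_sum]
    refine Finset.sum_congr rfl fun m _ => ?_
    simp only [besselProductAt]
    split_ifs with hm
    -- At m = 0 the term is the limit at 0+, which is the value at 0 of the entire extension.
    · rw [hm, Nat.cast_zero]; ring
    · rw [hc m (by exact_mod_cast Nat.pos_of_ne_zero hm), Complex.ofReal_natCast]; ring
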